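/- Let $L=4\ell$ with $\ell\in\mathbb N$, $\ell\ge 1$, let $\Gamma_L=\mathbb Z^2/L\mathbb Z^2$ be the periodic square lattice, and fix a hopping parameter $t>0$. For a $\mathbb Z_2$ gauge field $\sigma$, i.e. an assignment of a spin $\sigma_{x,\mu}\in\{\pm1\}$ to each edge $(x,x+e_\mu)$, $x\in\Gamma_L$, $\mu=1,2$, let $$H_f(\sigma)=-t\sum_{x\in\Gamma_L}\sum_{\mu=1,2}\big(a^+_x\,\sigma_{x,\mu}\,a^-_{x+e_\mu}+\text{h.c.}\big)$$ on the fermionic Fock space $\mathcal F_L$ over $\ell^2(\Gamma_L)$, where $a^\pm_x$ are the fermionic creation and annihilation operators, and for $\beta>0$ let $$Z^{\pm}_{\beta,L}(\sigma)=\operatorname{Tr}_{\mathcal F_L}(\pm1)^N e^{-\beta H_f(\sigma)},\qquad N=\sum_{x\in\Gamma_L} a^+_xa^-_x .$$ The flux of $\sigma$ through a plaquette or a closed loop is the product of the spins along it ($+1$: flux $0$; $-1$: flux $\pi$). Since $Z^\pm_{\beta,L}(\sigma)$ depends on $\sigma$ only through its plaquette fluxes $\Phi$ and its fluxes $a,b\in\{\pm1\}$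 through the non-contractible loops $\{x_2=0\}$ and $\{x_1=0\}$, we write it $Z^\pm_{\beta,L}(\Phi;a,b)$. Let $\Phi^*=(\phi^*_{i,j})$ be the chessboard configuration: $\phi^*_{i,j}=1$ if $i$ and $j$ are both odd and $\phi^*_{i,j}=-1$ otherwise, where $(i,j)$ is the upper right corner of the plaquette. Let $Z^\pm_*=Z^\pm_{\beta,L}(\pi;-1,-1)$ be the partition function of the $\pi$-flux phase (all plaquette fluxes $-1$) with $(a,b)=(-1,-1)$, and set, with $\log 0=-\infty$, $$\Delta^{\pm}_{\beta,L}=-\frac1{\beta L^2}\Big(\max_{a,b\in\{\pm1\}}\log Z^\pm_{\beta,L}(\Phi^*;a,b)-\log Z^\pm_*\Big).$$ Then, for each choice of the sign $\pm$ and for all sufficiently large $\beta$ and $\ell$, both $Z^\pm_*$ and $\max_{a,b}Z^\pm_{\beta,L}(\Phi^*;a,b)$ are strictly positive (so that $\Delta^\pm_{\beta,L}$ is a well-defined real number), and $$\begin{aligned}\Delta^\pm_{\beta,L}={}&\frac{t}{4\pi^2}\int_0^{2\pi}\!\!\int_0^{2\pi}dk_1dk_2\,\sqrt{1+\tfrac12\cos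 k_1+\tfrac12\cos k_2}\\&-\frac{t}{8\pi^2}\int_0^{2\pi}\!\!\int_0^{2\pi}dk_1dk_2\,\sqrt{1+\tfrac12\sqrt{1+\cos^2k_1+\cos^2k_2}}\\&-\frac{t}{8\pi^2}\int_0^{2\pi}\!\!\int_0^{2\pi}dk_1dk_2\,\sqrt{1-\tfrac12\sqrt{1+\cos^2k_1+\cos^2k_2}}+o(1),\end{aligned}$$ where $o(1)\to0$ as $\beta\to\infty$ and $\ell\to\infty$ jointly: for every $\varepsilon>0$ there are $\beta_0>0$ and $\ell_0$ such that the error is smaller than $\varepsilon$ in absolute value whenever $\beta\ge\beta_0$ and $\ell\ge\ell_0$. -/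

import Mathlib

noncomputable section

namespace Z2Gauge

/-- Sites of the periodic square lattice `ℤ² / L ℤ²`. -/
abbrev Site (L : ℕ) : Type := ZMod L × ZMod L

/-- Edges: `(x, μ)` is the edge joining `x` to `x + e_μ`, where `μ = 0` is the horizontal and
`μ = 1` the vertical direction. -/
abbrev Edge (L : ℕ) : Type := Site L × Fin 2

/-- The unit lattice vector in direction `μ`. -/
def unitVec (L : ℕ) (μ : Fin 2) : Site L := if μ = 0 then (1, 0) else (0, 1)

/-- A classical gauge field: a spin `±1` on every edge. -/
abbrev GaugeField (L : ℕ) : Type := Edge L → ℤˣ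

/-- The flux through an elementary plaquette, i.e. the product of the four spins on its boundary
(`1` is flux `0`, `-1` is flux `π`). The plaquette is labelled by its upper right corner `p`. -/
def plaquetteFlux {L : ℕ} (σ : GaugeField L) (p : Site L) : ℤˣ :=
  let e₁ := unitVec L 0
  let e₂ := unitVec L 1
  σ (p - e₁ - e₂, 0) * σ (p - e₂, 1) * σ (p - e₁, 0) * σ (p - e₁ - e₂, 1)

/-- The flux through the horizontal non-contractible loop `x₂ = 0`. -/
def loopFluxH {L : ℕ} [NeZero L] (σ : GaugeField L) : ℤˣ := ∏ i : ZMod L, σ ((i, 0), 0)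

/-- The flux through the vertical non-contractible loop `x₁ = 0`. -/
def loopFluxV {L : ℕ} [NeZero L] (σ : GaugeField L) : ℤˣ := ∏ j : ZMod L, σ ((0, j), 1)

/-- `σ` has plaquette fluxes `Φ`, and fluxes `a`, `b` through the two non-contractible loops. -/
def HasFluxes {L : ℕ} [NeZero L] (σ : GaugeField L) (Φ : Site L → ℤˣ) (a b : ℤˣ) : Prop :=
  (∀ p, plaquetteFlux σ p = Φ p) ∧ loopFluxH σ = a ∧ loopFluxV σ = b

/-- Operators on the fermionic Fock space over the sites, which has dimension `2 ^ (L ^ 2)`, as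
matrices in the occupation number basis; a basis vector is given by the set of occupied sites. -/
abbrev FockOp (L : ℕ) : Type := Matrix (Finset (Site L)) (Finset (Site L)) ℂ

/-- The position of a site in a fixed enumeration of the sites. -/
def siteIndex {L : ℕ} (x : Site L) : ℕ := x.1.val * L + x.2.val

/-- The annihilation operator `a⁻_x`: it removes the particle at `x`, with the usual sign
`(-1)^(number of occupied sites that precede x)`. -/
def annihilate {L : ℕ} (x : Site L) : FockOp L :=
  Matrix.of fun S T =>
    if x ∈ T ∧ S = T.erase x then
      (-1 : ℂ) ^ (T.filter fun y => siteIndex y < siteIndex x).card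
    else 0

/-- The creation operator `a⁺_x = (a⁻_x)*`. -/
def create {L : ℕ} (x : Site L) : FockOp L := (annihilate x).conjTranspose

/-- The hopping term `a⁺_x σ_{x,μ} a⁻_{x + e_μ}`. -/
def hop {L : ℕ} [NeZero L] (σ : GaugeField L) (x : Site L) (μ : Fin 2) : FockOp L :=
  (((σ (x, μ) : ℤˣ) : ℤ) : ℂ) • (create x * annihilate (x + unitVec L μ))

/-- The matter Hamiltonian
`H_f(σ) = -t ∑_x ∑_μ (a⁺_x σ_{x,μ} a⁻_{x + e_μ} + h.c.)`. -/
def matterHamiltonian {L : ℕ} [NeZero L] (t : ℝ) (σ : GaugeField L) : FockOp L :=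
  -((t : ℂ) • ∑ x : Site L, ∑ μ : Fin 2, (hop σ x μ + (hop σ x μ).conjTranspose))

/-- The operator `s ^ N` for a sign `s`, with `N` the number operator: the identity for `s = 1`
and the fermionic parity `(-1) ^ N` for `s = -1`. -/
def signPowNumber (L : ℕ) (s : ℤˣ) : FockOp L :=
  Matrix.diagonal fun S => ((s : ℤ) : ℂ) ^ S.card

/-- The even (`s = 1`) and odd (`s = -1`) partition functions `Tr s^N e^{-β H_f(σ)}` of the matter
sector at half filling (zero chemical potential). The trace is a real number. -/
def partitionOf {L : ℕ} [NeZero L] (s : ℤˣ) (t β : ℝ) (σ : GaugeField L) : ℝ :=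
  (Matrix.trace
    (signPowNumber L s * NormedSpace.exp (-((β : ℂ) • matterHamiltonian t σ)))).re

open Classical in
/-- `Z^s_{β,L}(Φ; a, b)`: the partition function in a gauge field with fluxes `Φ`, `a`, `b`. Gauge
fields with equal fluxes are gauge equivalent and have equal partition functions, so an arbitrary
one is taken (with value `0` if the fluxes are not those of any gauge field). -/
def partitionFn (L : ℕ) [NeZero L] (s : ℤˣ) (t β : ℝ) (Φ : Site L → ℤˣ) (a b : ℤˣ) : ℝ :=
  if h : ∃ σ : GaugeField L, HasFluxes σ Φ a b then partitionOf s t β h.choose else 0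

/-- The `π`-flux configuration: flux `π` through every plaquette. -/
def piFlux (L : ℕ) : Site L → ℤˣ := fun _ => -1

/-- The chessboard configuration: flux `0` through the plaquettes `(i, j)` with `i`, `j` both odd,
flux `π` through all others (for even `L`, parity does not depend on the representatives). -/
def chessFlux (L : ℕ) : Site L → ℤˣ := fun p => if Odd p.1.val ∧ Odd p.2.val then 1 else -1

/-- `Z^s_*`: the partition function of the `π`-flux phase with loop fluxes `(-1, -1)`. -/
def partitionStar (L : ℕ) [NeZero L] (s : ℤˣ) (t β : ℝ) : ℝ :=
  partitionFn L s t β (piFlux L) (-1) (-1)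

/-- `max_{a,b} Z^s_{β,L}(Φ*; a, b)` for the chessboard configuration `Φ*`. -/
def partitionChessMax (L : ℕ) [NeZero L] (s : ℤˣ) (t β : ℝ) : ℝ :=
  Finset.univ.sup' Finset.univ_nonempty
    fun ab : ℤˣ × ℤˣ => partitionFn L s t β (chessFlux L) ab.1 ab.2

/-- The monopole mass at finite temperature and volume,
`Δ^s_{β,L} = -(1 / (β L²)) (max_{a,b} log Z^s_{β,L}(Φ*; a, b) - log Z^s_*)`.
The logarithm, with `log 0 = -∞`, is increasing, so the maximum is taken inside it. -/
def monopoleMass (L : ℕ) [NeZero L] (s : ℤˣ) (t β : ℝ) : ℝ :=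
  -(1 / (β * (L : ℝ) ^ 2)) *
    (Real.log (partitionChessMax L s t β) - Real.log (partitionStar L s t β))

end Z2Gauge

end

/-! Integrating out the free fermions gives Z^s = ∏_k (1 + s e^{βtλ_k}), where the λ_k are the
eigenvalues of the hopping matrix A = T₁ + T₁* + T₂ + T₂* and T_μ are the magnetic translations. The
lattice is bipartite, so the spectrum is symmetric and log Z^s = Σ_k (βt|λ_k|/2 + log(1 + s
e^{-βt|λ_k|})) (`log_partitionOf`). The first term yields the ground state energy. The second,
divided by βL², is O(1/β) uniformly in L, provided that eigenvalues near zero do no harm when s = -1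
(`free_energy_estimate`).

The spectra come from operator identities, without Bloch waves. In the π-flux phase T₁ and T₂
anticommute, so A² = 4 + T₁² + T₁*² + T₂² + T₂*² with commuting summands. In the chessboard
configuration A² - 4 = D + 2Q, where D is the sum of the squared translations and Q is the product
of two commuting reflections that exchange neighbouring columns and rows. Since D and Q anticommute
and Q² = 1, (A² - 4)² = D² + 4 = 8 + T₁⁴ + T₁*⁴ + T₂⁴ + T₂*⁴, again with commuting summands; a sign
operator reverses A² - 4. The commuting powers have nontrivial monomials of trace zero, and their
M-th powers are the loop fluxes. Hence all moments agree with those of λ² = 4 + 2cos θ + 2cos φ,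
respectively λ² = 4 ± √(8 + 2cos θ + 2cos φ), over twisted angles. Equal moments give equal sums of
every function (`pi_density`, `chess_density`).

The chessboard spectrum has a gap. The π-flux spectrum closes at Dirac points in the limit, but for
loop fluxes (-1, -1) and even M the product of the factors 2 + 2cos θ is exactly 4
(`prod_two_add_cos`), so Σ log|λ_k| ≥ 0, which is control enough. The energy densities are Riemann
sums converging uniformly in the twists, so it is immaterial which (a, b) attains the maximum. -/

noncomputable section

namespace Z2Gauge

/-! ### Free fermions from the canonical anticommutation relations -/

section

open Matrix NormedSpace

/-- The exponential of a multiple of an idempotent matrix. -/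
theorem exp_smul_idempotent {κ : Type*} [Fintype κ] [DecidableEq κ] {P : Matrix κ κ ℂ}
    (hP : P * P = P) (c : ℂ) : exp (c • P) = 1 + (Complex.exp c - 1) • P := by
  open scoped Norms.Operator in
  have h1 : HasSum (fun n : ℕ => ((n.factorial : ℂ)⁻¹ • (c • P) ^ n)) (exp (c • P)) :=
    exp_series_hasSum_exp' (𝕂 := ℂ) _
  have h2 : HasSum (fun n : ℕ => ((n.factorial : ℂ)⁻¹ • c ^ n)) (Complex.exp c) := by
    have := exp_series_hasSum_exp' (𝕂 := ℂ) c
    rwa [← Complex.exp_eq_exp_ℂ] at this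
  -- For n ≥ 1 the power P ^ n is P, but P ^ 0 is 1: the exponential series is that of `c` times
  -- `P`, plus the correction `1 - P` in the term n = 0.
  have h3 : HasSum (fun n : ℕ => if n = 0 then (1 - P) else 0) (1 - P) := hasSum_ite_eq 0 _
  have h4 := (h2.smul_const P).add h3
  have h5 : ∀ n : ℕ, P ^ (n + 1) = P := by
    intro n
    induction n with
    | zero => simp
    | succ n ih => rw [pow_succ, ih, hP]
  have h6 : (fun n : ℕ => ((n.factorial : ℂ)⁻¹ • (c • P) ^ n)) =
      fun n : ℕ => ((n.factorial : ℂ)⁻¹ • c ^ n) • P + if n = 0 then (1 - P) else 0 := by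
    funext n
    cases n with
    | zero => simp
    | succ n => simp [smul_pow, h5, smul_smul]
  rw [h6] at h1
  rw [h1.unique h4, sub_smul, one_smul]
  abel

/-- The canonical anticommutation relations for a family of annihilation operators. -/
structure IsCAR {ι κ : Type*} [Fintype κ] [DecidableEq ι] [DecidableEq κ]
    (a : ι → Matrix κ κ ℂ) : Prop where
  anticomm : ∀ i j, a i * a j + a j * a i = 0
  anticomm_star : ∀ i j, a i * (a j)ᴴ + (a j)ᴴ * a i = if i = j then 1 else 0

namespace IsCAR

variable {ι κ : Type*} [Fintype κ] [DecidableEq ι] [DecidableEq κ] {a : ι → Matrix κ κ ℂ}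

theorem sq_eq_zero (h : IsCAR a) (i : ι) : a i * a i = 0 := by
  have := h.anticomm i i
  rw [← two_smul ℂ] at this
  exact (smul_eq_zero.mp this).resolve_left two_ne_zero

theorem number_idempotent (h : IsCAR a) (i : ι) :
    ((a i)ᴴ * a i) * ((a i)ᴴ * a i) = (a i)ᴴ * a i := by
  have h1 := h.anticomm_star i i
  rw [if_pos rfl] at h1
  have h2 : a i * (a i)ᴴ = 1 - (a i)ᴴ * a i := eq_sub_of_add_eq h1
  calc ((a i)ᴴ * a i) * ((a i)ᴴ * a i) = (a i)ᴴ * (a i * (a i)ᴴ) * a i := by noncomm_ring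
    _ = (a i)ᴴ * a i - (a i)ᴴ * (a i)ᴴ * (a i * a i) := by rw [h2]; noncomm_ring
    _ = _ := by rw [h.sq_eq_zero]; simp

theorem number_commute (h : IsCAR a) {i j : ι} (hij : i ≠ j) : Commute (a i) ((a j)ᴴ * a j) := by
  have h1 := h.anticomm_star i j
  rw [if_neg hij] at h1
  have h2 : a i * (a j)ᴴ = - ((a j)ᴴ * a i) := eq_neg_of_add_eq_zero_left h1
  have h3 : a i * a j = - (a j * a i) := eq_neg_of_add_eq_zero_left (h.anticomm i j)
  show a i * ((a j)ᴴ * a j) = (a j)ᴴ * a j * a i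
  rw [← mul_assoc, h2, neg_mul, mul_assoc, h3, mul_neg, neg_neg, mul_assoc]

theorem number_commute_number (h : IsCAR a) (i j : ι) :
    Commute ((a i)ᴴ * a i) ((a j)ᴴ * a j) := by
  by_cases hij : i = j
  · rw [hij]
  · refine Commute.mul_left ?_ (h.number_commute hij)
    have h1 := (h.number_commute hij).eq
    have h2 := congrArg conjTranspose h1
    simp only [conjTranspose_mul, conjTranspose_conjTranspose] at h2
    exact h2.symm

/-- Cyclicity of the trace turns a*a into aa* = 1 - a*a, so the occupied and empty states of the
mode carry equal traces. This allows the modes to be traced out one at a time. -/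
theorem trace_number_mul (h : IsCAR a) (i : ι) {X : Matrix κ κ ℂ} (hX : Commute (a i) X) :
    trace ((a i)ᴴ * a i * X) = trace X / 2 := by
  have h1 := h.anticomm_star i i
  rw [if_pos rfl] at h1
  have h2 : a i * (a i)ᴴ = 1 - (a i)ᴴ * a i := eq_sub_of_add_eq h1
  have h3 : trace ((a i)ᴴ * a i * X) = trace X - trace ((a i)ᴴ * a i * X) := by
    conv_lhs => rw [mul_assoc, trace_mul_comm, hX.eq, mul_assoc, h2, trace_mul_comm, sub_mul,
      one_mul, trace_sub]
  linear_combination h3 / 2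

/-- The trace of the exponential of a combination of number operators. -/
theorem trace_exp_sum (h : IsCAR a) (c : ι → ℂ) (K : Finset ι) :
    trace (exp (∑ k ∈ K, c k • ((a k)ᴴ * a k))) =
      (∏ k ∈ K, ((1 + Complex.exp (c k)) / 2)) * Fintype.card κ := by
  induction K using Finset.induction_on with
  | empty => simp
  | insert j K hj ih =>
    rw [Finset.sum_insert hj, Finset.prod_insert hj]
    have hc : Commute (c j • ((a j)ᴴ * a j)) (∑ k ∈ K, c k • ((a k)ᴴ * a k)) :=
      Commute.sum_right _ _ _ fun k _ =>
        ((h.number_commute_number j k).smul_left _).smul_right _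
    have hb : Commute (a j) (exp (∑ k ∈ K, c k • ((a k)ᴴ * a k))) := by
      open scoped Norms.Operator in
      refine Commute.exp_right (Commute.sum_right _ _ _ fun k hk => ?_)
      exact (h.number_commute (by rintro rfl; exact hj hk)).smul_right _
    rw [Matrix.exp_add_of_commute _ _ hc, exp_smul_idempotent (h.number_idempotent j), add_mul,
      one_mul, smul_mul_assoc, trace_add, trace_smul, h.trace_number_mul j hb, ih, smul_eq_mul]
    ring

variable [Fintype ι]

/-- Rotating the annihilation operators by a unitary matrix preserves the relations. -/
theorem rotate (h : IsCAR a) {V : Matrix ι ι ℂ} (hV : Vᴴ * V = 1) :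
    IsCAR fun k => ∑ x, star (V x k) • a x := by
  constructor
  · intro i j
    simp only [Finset.sum_mul, Finset.mul_sum, smul_mul_smul_comm]
    rw [Finset.sum_comm, ← Finset.sum_add_distrib]
    refine Finset.sum_eq_zero fun x _ => ?_
    rw [← Finset.sum_add_distrib]
    refine Finset.sum_eq_zero fun y _ => ?_
    rw [mul_comm (star (V y j)), ← smul_add, h.anticomm, smul_zero]
  · intro i j
    simp only [conjTranspose_sum, conjTranspose_smul, star_star, Finset.sum_mul, Finset.mul_sum,
      smul_mul_smul_comm]
    rw [Finset.sum_comm, ← Finset.sum_add_distrib]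
    have : ∀ x, ∑ y, (star (V x i) * V y j) • (a x * (a y)ᴴ) +
        ∑ y, (V y j * star (V x i)) • ((a y)ᴴ * a x) = (star (V x i) * V x j) • 1 := by
      intro x
      rw [← Finset.sum_add_distrib, Finset.sum_eq_single x]
      · rw [mul_comm (V x j), ← smul_add, h.anticomm_star, if_pos rfl]
      · intro y _ hy
        rw [mul_comm (V y j), ← smul_add, h.anticomm_star, if_neg hy.symm, smul_zero]
      · simp
    rw [Finset.sum_congr rfl fun x _ => this x, ← Finset.sum_smul]
    have h2 := congrFun (congrFun hV i) j
    simp only [mul_apply, conjTranspose_apply] at h2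
    rw [h2, one_apply]
    split_ifs <;> simp

/-- A quadratic Hamiltonian is diagonalized together with its one-particle matrix. -/
theorem sum_diagonalized (V : Matrix ι ι ℂ) (d : ι → ℂ) :
    ∑ x, ∑ y, (V * diagonal d * Vᴴ) x y • ((a x)ᴴ * a y) =
      ∑ k, d k • ((∑ x, star (V x k) • a x)ᴴ * ∑ x, star (V x k) • a x) := by
  simp only [conjTranspose_sum, conjTranspose_smul, star_star, Finset.sum_mul, Finset.mul_sum,
      smul_mul_smul_comm, Finset.smul_sum, smul_smul]
  simp only [mul_apply (M := V * diagonal d), mul_diagonal, conjTranspose_apply, Finset.sum_smul]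
  rw [Finset.sum_comm]
  rw [Finset.sum_congr rfl fun y _ => Finset.sum_comm, Finset.sum_comm]
  refine Finset.sum_congr rfl fun k _ => Finset.sum_congr rfl fun y _ =>
    Finset.sum_congr rfl fun x _ => ?_
  congr 1
  ring

/-- The grand canonical partition function of free fermions. -/
theorem trace_exp_mul_exp (h : IsCAR a) {A : Matrix ι ι ℂ} (hA : A.IsHermitian) (z w : ℂ) :
    trace (exp (z • ∑ x, (a x)ᴴ * a x) * exp (w • ∑ x, ∑ y, A x y • ((a x)ᴴ * a y))) =
      (∏ k, ((1 + Complex.exp (z + w * hA.eigenvalues k)) / 2)) * Fintype.card κ := by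
  set V : Matrix ι ι ℂ := hA.eigenvectorUnitary.1
  have hV : Vᴴ * V = 1 := (Matrix.mem_unitaryGroup_iff').mp hA.eigenvectorUnitary.2
  have hV' : V * Vᴴ = 1 := (Matrix.mem_unitaryGroup_iff).mp hA.eigenvectorUnitary.2
  set b : ι → Matrix κ κ ℂ := fun k => ∑ x, star (V x k) • a x with hb
  have hbC : IsCAR b := h.rotate hV
  have e1 : ∑ x, (a x)ᴴ * a x = ∑ k, (b k)ᴴ * b k := by
    have := sum_diagonalized (a := a) V (fun _ => 1)
    rw [show diagonal (fun _ : ι => (1 : ℂ)) = 1 from diagonal_one, mul_one, hV'] at this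
    simpa [hb, one_apply, ite_smul] using this
  have e2 : ∑ x, ∑ y, A x y • ((a x)ᴴ * a y) =
      ∑ k, (hA.eigenvalues k : ℂ) • ((b k)ᴴ * b k) := by
    have := sum_diagonalized (a := a) V (fun k => (hA.eigenvalues k : ℂ))
    rw [← this]
    have hs : A = V * diagonal (fun k => (hA.eigenvalues k : ℂ)) * Vᴴ := by
      conv_lhs => rw [hA.spectral_theorem]
      rfl
    rw [← hs]
  rw [e1, e2, Finset.smul_sum, Finset.smul_sum]
  have hc : Commute (∑ k, z • ((b k)ᴴ * b k))
      (∑ k, w • (hA.eigenvalues k : ℂ) • ((b k)ᴴ * b k)) :=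
    Commute.sum_left _ _ _ fun k _ => Commute.sum_right _ _ _ fun l _ =>
      (((hbC.number_commute_number k l).smul_left _).smul_right _).smul_right _
  rw [← Matrix.exp_add_of_commute _ _ hc, ← Finset.sum_add_distrib]
  simp only [smul_smul, ← add_smul]
  exact hbC.trace_exp_sum _ _

end IsCAR

end

/-! ### Jordan–Wigner operators and the product formula for the trace -/

section

open Matrix NormedSpace

theorem siteIndex_injective {L : ℕ} [NeZero L] : Function.Injective (siteIndex (L := L)) := by
  intro x y h
  unfold siteIndex at h
  have hx := ZMod.val_lt x.2
  have hy := ZMod.val_lt y.2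
  have h2 : x.2.val = y.2.val := by
    have := congrArg (· % L) h
    simpa [Nat.add_mod, Nat.mod_eq_of_lt hx, Nat.mod_eq_of_lt hy] using this
  have h1 : x.1.val = y.1.val := by
    rw [h2] at h
    exact Nat.eq_of_mul_eq_mul_right (Nat.pos_of_ne_zero (NeZero.ne L)) (Nat.add_right_cancel h)
  exact Prod.ext (ZMod.val_injective L h1) (ZMod.val_injective L h2)

/-- The Jordan–Wigner sign of a site with respect to a set of occupied sites. -/
def jwSign {L : ℕ} (x : Site L) (T : Finset (Site L)) : ℂ :=
  (-1 : ℂ) ^ (T.filter fun y => siteIndex y < siteIndex x).card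

theorem jwSign_mul_self {L : ℕ} (x : Site L) (T : Finset (Site L)) :
    jwSign x T * jwSign x T = 1 := by
  unfold jwSign
  rw [← mul_pow]; simp

theorem star_jwSign {L : ℕ} (x : Site L) (T : Finset (Site L)) :
    star (jwSign x T) = jwSign x T := by
  simp [jwSign]

/-- The sign picked up when two annihilation operators are exchanged. -/
def orderSign {L : ℕ} (x y : Site L) : ℂ := if siteIndex y < siteIndex x then -1 else 1

/-- Of two distinct sites exactly one precedes the other. This is the source of all minus signs in
the anticommutation relations. -/
theorem orderSign_swap {L : ℕ} [NeZero L] {x y : Site L} (h : x ≠ y) :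
    orderSign x y = - orderSign y x := by
  unfold orderSign
  rcases lt_trichotomy (siteIndex x) (siteIndex y) with h1 | h1 | h1
  · simp [h1, h1.not_gt]
  · exact absurd (siteIndex_injective h1) h
  · simp [h1, h1.not_gt]

theorem orderSign_mul_self {L : ℕ} (x y : Site L) : orderSign x y * orderSign x y = 1 := by
  unfold orderSign; split_ifs <;> simp

theorem jwSign_insert {L : ℕ} (x : Site L) {y : Site L} {T : Finset (Site L)} (hy : y ∉ T) :
    jwSign x (insert y T) = orderSign x y * jwSign x T := by
  unfold jwSign orderSign
  rw [Finset.filter_insert]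
  split_ifs with h
  · rw [Finset.card_insert_of_notMem (by simp [hy]), pow_succ]; ring
  · simp

theorem jwSign_erase {L : ℕ} (x : Site L) {y : Site L} {T : Finset (Site L)} (hy : y ∈ T) :
    jwSign x (T.erase y) = orderSign x y * jwSign x T := by
  have h := jwSign_insert x (Finset.notMem_erase y T)
  rw [Finset.insert_erase hy] at h
  rw [h, ← mul_assoc, orderSign_mul_self, one_mul]

theorem annihilate_apply {L : ℕ} (x : Site L) (S T : Finset (Site L)) :
    annihilate x S T = if x ∈ T ∧ S = T.erase x then jwSign x T else 0 := rfl

theorem mul_annihilate_apply {L : ℕ} [NeZero L] (M : FockOp L) (y : Site L)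
    (S T : Finset (Site L)) :
    (M * annihilate y) S T = if y ∈ T then M S (T.erase y) * jwSign y T else 0 := by
  rw [mul_apply, Finset.sum_eq_single (T.erase y)]
  · rw [annihilate_apply]; simp
  · intro R _ hR
    rw [annihilate_apply, if_neg (fun h => hR h.2), mul_zero]
  · simp

theorem mul_create_apply {L : ℕ} [NeZero L] (M : FockOp L) (y : Site L)
    (S T : Finset (Site L)) :
    (M * (annihilate y)ᴴ) S T =
      if y ∈ T then 0 else M S (insert y T) * jwSign y (insert y T) := by
  rw [mul_apply, Finset.sum_eq_single (insert y T)]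
  · rw [conjTranspose_apply, annihilate_apply]
    by_cases hy : y ∈ T
    · have : T ≠ (insert y T).erase y := fun h => Finset.notMem_erase y (insert y T) (h ▸ hy)
      rw [if_pos hy, if_neg fun h => this h.2, star_zero, mul_zero]
    · simp [hy, star_jwSign]
  · intro R _ hR
    rw [conjTranspose_apply, annihilate_apply, if_neg, star_zero, mul_zero]
    rintro ⟨h1, rfl⟩
    exact hR (Finset.insert_erase h1).symm
  · simp

/-- Changing the occupation of two different sites in either order leads to the same set, and the
two Jordan–Wigner signs are opposite because each order registers the change on one side only. For
equal sites, exactly one of aa* and a*a is nonzero on each basis vector. -/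
theorem isCAR_annihilate (L : ℕ) [NeZero L] : IsCAR (annihilate (L := L)) := by
  constructor
  · intro x y
    ext S T
    rw [Matrix.add_apply, mul_annihilate_apply, mul_annihilate_apply, annihilate_apply, annihilate_apply,
      Matrix.zero_apply]
    by_cases hxy : x = y
    · subst hxy; simp
    · by_cases hx : x ∈ T
      · by_cases hy : y ∈ T
        · simp only [hx, hy, Finset.mem_erase, ne_eq, hxy, Ne.symm hxy, not_false_eq_true,
            and_self, true_and, if_true, Finset.erase_right_comm (a := x)]
          split_ifs with h
          · rw [jwSign_erase x hy, jwSign_erase y hx, orderSign_swap hxy]; ring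
          · simp
        · simp [hy]
      · simp [hx]
  · intro x y
    ext S T
    rw [Matrix.add_apply, mul_annihilate_apply, mul_create_apply, conjTranspose_apply, annihilate_apply,
      annihilate_apply]
    by_cases hxy : x = y
    · subst hxy
      rw [if_pos rfl, one_apply]
      by_cases hx : x ∈ T
      · by_cases hS : S = T
        · subst hS; simp [hx, star_jwSign, jwSign_mul_self]
        · have : ¬ (x ∈ S ∧ T.erase x = S.erase x) := by
            rintro ⟨h1, h2⟩
            apply hS
            rw [← Finset.insert_erase h1, ← h2, Finset.insert_erase hx]
          rw [if_pos hx, if_pos hx, if_neg this, if_neg hS]; simp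
      · rw [if_neg hx, if_neg hx, Finset.erase_insert hx]
        simp only [Finset.mem_insert_self, true_and, add_zero, ite_mul, zero_mul, jwSign_mul_self]
    · rw [if_neg hxy, Matrix.zero_apply]
      by_cases hx : x ∈ T
      · by_cases hy : y ∈ T
        · have : ¬ (y ∈ S ∧ T.erase x = S.erase y) := by
            rintro ⟨h1, h2⟩
            apply Finset.notMem_erase y S
            rw [← h2]
            exact Finset.mem_erase.mpr ⟨Ne.symm hxy, hy⟩
          rw [if_pos hy, if_pos hx, if_neg this]; simp
        · have hiff : (x ∈ insert y T ∧ S = (insert y T).erase x) ↔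
              (y ∈ S ∧ T.erase x = S.erase y) := by
            constructor
            · rintro ⟨_, rfl⟩
              refine ⟨Finset.mem_erase.mpr ⟨Ne.symm hxy, Finset.mem_insert_self _ _⟩, ?_⟩
              rw [Finset.erase_right_comm, Finset.erase_insert hy]
            · rintro ⟨h1, h2⟩
              refine ⟨Finset.mem_insert_of_mem hx, ?_⟩
              rw [← Finset.insert_erase h1, ← h2, Finset.erase_insert_of_ne (Ne.symm hxy)]
          rw [if_neg hy, if_pos hx]
          by_cases h : x ∈ insert y T ∧ S = (insert y T).erase x
          · rw [if_pos h, if_pos (hiff.mp h), star_jwSign, h.2, jwSign_erase y h.1,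
              jwSign_insert x hy, orderSign_swap hxy]
            ring
          · rw [if_neg h, if_neg (fun h' => h (hiff.mpr h'))]; simp
      · have : ¬ (x ∈ insert y T ∧ S = (insert y T).erase x) := by
          rintro ⟨h1, -⟩
          rcases Finset.mem_insert.mp h1 with h | h
          · exact hxy h
          · exact hx h
        rw [if_neg this, if_neg hx]; simp

theorem number_eq_diagonal {L : ℕ} [NeZero L] (x : Site L) :
    (annihilate x)ᴴ * annihilate x = diagonal fun S => if x ∈ S then 1 else 0 := by
  ext S T
  rw [mul_annihilate_apply, conjTranspose_apply, annihilate_apply, diagonal_apply]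
  by_cases hx : x ∈ T
  · by_cases hS : S = T
    · subst hS; simp [hx, star_jwSign, jwSign_mul_self]
    · have : ¬ (x ∈ S ∧ T.erase x = S.erase x) := by
        rintro ⟨h1, h2⟩
        apply hS
        rw [← Finset.insert_erase h1, ← h2, Finset.insert_erase hx]
      rw [if_pos hx, if_neg this, if_neg hS]; simp
  · rw [if_neg hx]
    split_ifs with h1 h2
    · exact absurd (h1 ▸ h2) hx
    · rfl
    · rfl

theorem sum_number {L : ℕ} [NeZero L] :
    ∑ x : Site L, (annihilate x)ᴴ * annihilate x = diagonal fun S => (S.card : ℂ) := by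
  simp only [number_eq_diagonal]
  ext S T
  rw [Matrix.sum_apply]
  simp only [diagonal_apply]
  split_ifs with h <;> simp

/-- A complex logarithm of the sign `s`. -/
def signLog (s : ℤˣ) : ℂ := if s = 1 then 0 else Real.pi * Complex.I

theorem exp_signLog (s : ℤˣ) : Complex.exp (signLog s) = ((s : ℤ) : ℂ) := by
  unfold signLog
  rcases Int.units_eq_one_or s with rfl | rfl <;> simp

/-- As an exponential of N, the sign merely shifts the one-particle energies by a complex chemical
potential, so a single product formula serves both partition functions. -/
theorem signPowNumber_eq_exp {L : ℕ} [NeZero L] (s : ℤˣ) :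
    signPowNumber L s = exp (signLog s • ∑ x : Site L, (annihilate x)ᴴ * annihilate x) := by
  rw [sum_number, ← diagonal_smul, Matrix.exp_diagonal, signPowNumber]
  congr 1
  funext S
  rw [Pi.coe_exp, ← Complex.exp_eq_exp_ℂ, Pi.smul_apply, smul_eq_mul, mul_comm,
    Complex.exp_nat_mul, exp_signLog]

/-- The free-fermion formula for the partition function of a quadratic Hamiltonian with
one-particle matrix `-t A`. -/
theorem trace_sign_exp {L : ℕ} [NeZero L] (s : ℤˣ) (t β : ℝ) {A : Matrix (Site L) (Site L) ℂ}
    (hA : A.IsHermitian) :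
    trace (signPowNumber L s * exp (-((β : ℂ) • (-((t : ℂ) •
      ∑ x, ∑ y, A x y • ((annihilate x)ᴴ * annihilate y)))))) =
      ((∏ k, (1 + ((s : ℤ) : ℝ) * Real.exp (β * t * hA.eigenvalues k)) : ℝ) : ℂ) := by
  rw [signPowNumber_eq_exp, smul_neg, neg_neg, smul_smul,
    (isCAR_annihilate L).trace_exp_mul_exp hA]
  rw [Finset.prod_div_distrib]
  simp only [Finset.prod_const, Fintype.card_finset, Complex.exp_add, exp_signLog,
    Finset.card_univ]
  push_cast
  -- The halves, one for each site, cancel the dimension of the Fock space.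
  exact div_mul_cancel₀ _ (by simp)

end

/-! ### Algebra of magnetic translations -/

section

set_option linter.unusedSimpArgs false

section FluxAlgebra

variable {R : Type*} [Ring R]

/-- Two pairs of mutually inverse elements which anticommute. -/
structure PiFluxRelations (T₁ T₁' T₂ T₂' : R) : Prop where
  inv₁ : T₁ * T₁' = 1
  inv₁' : T₁' * T₁ = 1
  inv₂ : T₂ * T₂' = 1
  inv₂' : T₂' * T₂ = 1
  anticomm : T₁ * T₂ = -(T₂ * T₁)

namespace PiFluxRelations

variable {T₁ T₁' T₂ T₂' : R}

theorem flip₁ (h : PiFluxRelations T₁ T₁' T₂ T₂') : PiFluxRelations T₁' T₁ T₂ T₂' := by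
  refine ⟨h.inv₁', h.inv₁, h.inv₂, h.inv₂', ?_⟩
  calc T₁' * T₂ = T₁' * T₂ * (T₁ * T₁') := by rw [h.inv₁, mul_one]
    _ = -(T₁' * (-(T₂ * T₁)) * T₁') := by noncomm_ring
    _ = -(T₁' * T₁ * T₂ * T₁') := by rw [← h.anticomm]; noncomm_ring
    _ = _ := by rw [h.inv₁', one_mul]

theorem symm (h : PiFluxRelations T₁ T₁' T₂ T₂') : PiFluxRelations T₂ T₂' T₁ T₁' :=
  ⟨h.inv₂, h.inv₂', h.inv₁, h.inv₁', by rw [h.anticomm, neg_neg]⟩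

/-- Each mixed product of the two directions cancels against its reverse; the four products of
mutually inverse elements give the 4. -/
theorem sq_sum (h : PiFluxRelations T₁ T₁' T₂ T₂') :
    (T₁ + T₁' + T₂ + T₂') ^ 2 = 4 + T₁ ^ 2 + T₁' ^ 2 + T₂ ^ 2 + T₂' ^ 2 := by
  have a1 := h.anticomm
  have a2 := h.flip₁.anticomm
  have a3 := h.symm.flip₁.symm.anticomm
  have a4 := h.flip₁.symm.flip₁.symm.anticomm
  have h4 : (4 : R) = 1 + 1 + 1 + 1 := by norm_num
  simp only [pow_two, mul_add, add_mul, a1, a2, a3, a4, h.inv₁, h.inv₁', h.inv₂, h.inv₂', h4]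
  abel

theorem commute_sq (h : PiFluxRelations T₁ T₁' T₂ T₂') : Commute (T₁ ^ 2) T₂ := by
  show _ = _
  rw [pow_two, mul_assoc, h.anticomm, mul_neg, ← mul_assoc, h.anticomm]
  noncomm_ring

end PiFluxRelations

/-- The relations of magnetic translations in the chessboard flux configuration: `E₁` and `E₂`
project on the even columns and rows. -/
structure ChessRelations (T₁ T₁' E₁ T₂ T₂' E₂ : R) : Prop where
  inv₁ : T₁ * T₁' = 1
  inv₁' : T₁' * T₁ = 1
  inv₂ : T₂ * T₂' = 1
  inv₂' : T₂' * T₂ = 1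
  idem₁ : E₁ * E₁ = E₁
  idem₂ : E₂ * E₂ = E₂
  comm : E₂ * E₁ = E₁ * E₂
  shift₁ : E₁ * T₁ = T₁ - T₁ * E₁
  shift₂ : E₂ * T₂ = T₂ - T₂ * E₂
  comm₁₂ : E₁ * T₂ = T₂ * E₁
  comm₂₁ : E₂ * T₁ = T₁ * E₂
  flux : T₁ * T₂ = (E₁ * E₂ + E₁ * E₂ - 1) * (T₂ * T₁)

namespace ChessRelations

variable {T₁ T₁' E₁ T₂ T₂' E₂ : R}

theorem assoc_right {a b c : R} (h : a * b = c) (x : R) : a * (b * x) = c * x := by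
  rw [← mul_assoc, h]

theorem shift₁' (h : ChessRelations T₁ T₁' E₁ T₂ T₂' E₂) : E₁ * T₁' = T₁' - T₁' * E₁ := by
  have h1 : T₁' * (E₁ * T₁) * T₁' = T₁' * (T₁ - T₁ * E₁) * T₁' := by rw [h.shift₁]
  have h2 : T₁' * (E₁ * T₁) * T₁' = T₁' * E₁ * (T₁ * T₁') := by noncomm_ring
  have h3 : T₁' * (T₁ - T₁ * E₁) * T₁' = (T₁' * T₁) * T₁' - (T₁' * T₁) * (E₁ * T₁') := by
    noncomm_ring
  rw [h2, h3, h.inv₁, h.inv₁', mul_one, one_mul, one_mul] at h1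
  rw [h1]; abel

theorem comm₁₂' (h : ChessRelations T₁ T₁' E₁ T₂ T₂' E₂) : E₁ * T₂' = T₂' * E₁ := by
  calc E₁ * T₂' = T₂' * (T₂ * E₁) * T₂' := by rw [← mul_assoc, h.inv₂', one_mul]
    _ = T₂' * E₁ * (T₂ * T₂') := by rw [← h.comm₁₂]; noncomm_ring
    _ = _ := by rw [h.inv₂, mul_one]

/-- The flux factor 2E₁E₂ - 1 is an involution, so it can be moved to the other side. This makes the
relations symmetric in the two directions. -/
theorem flux_symm (h : ChessRelations T₁ T₁' E₁ T₂ T₂' E₂) :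
    T₂ * T₁ = (E₁ * E₂ + E₁ * E₂ - 1) * (T₁ * T₂) := by
  have hF : (E₁ * E₂ + E₁ * E₂ - 1) * (E₁ * E₂ + E₁ * E₂ - 1) = 1 := by
    simp only [mul_add, add_mul, mul_sub, sub_mul, mul_assoc, h.idem₂, assoc_right h.comm,
      assoc_right h.idem₁, mul_one, one_mul]
    abel
  rw [h.flux, ← mul_assoc, hF, one_mul]

theorem symm (h : ChessRelations T₁ T₁' E₁ T₂ T₂' E₂) : ChessRelations T₂ T₂' E₂ T₁ T₁' E₁ :=
  ⟨h.inv₂, h.inv₂', h.inv₁, h.inv₁', h.idem₂, h.idem₁, h.comm.symm, h.shift₂, h.shift₁, h.comm₂₁,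
    h.comm₁₂, by rw [h.comm]; exact h.flux_symm⟩

theorem mul_inv_swap (h : ChessRelations T₁ T₁' E₁ T₂ T₂' E₂) :
    T₁ * T₂' = T₂' * (E₁ * E₂ + E₁ * E₂ - 1) * T₁ := by
  calc T₁ * T₂' = T₂' * (T₂ * T₁) * T₂' := by rw [← mul_assoc, h.inv₂', one_mul]
    _ = T₂' * (E₁ * E₂ + E₁ * E₂ - 1) * T₁ * (T₂ * T₂') := by rw [h.flux_symm]; noncomm_ring
    _ = _ := by rw [h.inv₂, mul_one]

theorem inv_mul_inv_swap (h : ChessRelations T₁ T₁' E₁ T₂ T₂' E₂) :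
    T₂' * T₁' = T₁' * T₂' * (E₁ * E₂ + E₁ * E₂ - 1) := by
  calc T₂' * T₁' = T₁' * T₂' * (T₂ * T₁) * T₂' * T₁' := by
        rw [show T₁' * T₂' * (T₂ * T₁) * T₂' * T₁' = T₁' * (T₂' * T₂) * T₁ * T₂' * T₁' by
          noncomm_ring, h.inv₂', mul_one, h.inv₁', one_mul]
    _ = T₁' * T₂' * (E₁ * E₂ + E₁ * E₂ - 1) * T₁ * (T₂ * T₂') * T₁' := by
        rw [h.flux_symm]; noncomm_ring
    _ = T₁' * T₂' * (E₁ * E₂ + E₁ * E₂ - 1) * (T₁ * T₁') := by rw [h.inv₂]; noncomm_ring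
    _ = _ := by rw [h.inv₁, mul_one]

/-- Reflection of neighbouring columns. -/
theorem pair_sq (h : ChessRelations T₁ T₁' E₁ T₂ T₂' E₂) :
    (E₁ * T₁ + T₁' * E₁) * (E₁ * T₁ + T₁' * E₁) = 1 := by
  -- The element exchanges each even column with its right neighbour: the first term acts on even
  -- columns, the second on odd ones.
  simp only [mul_add, add_mul, mul_sub, sub_mul, mul_assoc, h.shift₁, h.shift₁',
    assoc_right h.shift₁, assoc_right h.shift₁', h.idem₁, assoc_right h.idem₁, h.inv₁, h.inv₁',
    assoc_right h.inv₁, assoc_right h.inv₁', one_mul, mul_one]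
  abel

theorem proj_mul_flux (h : ChessRelations T₁ T₁' E₁ T₂ T₂' E₂) :
    (E₁ * E₂) * (E₁ * E₂ + E₁ * E₂ - 1) = E₁ * E₂ := by
  simp only [mul_add, add_mul, mul_sub, sub_mul, mul_assoc, h.idem₂, assoc_right h.comm,
      assoc_right h.idem₁, mul_one, one_mul]
  abel

theorem flux_mul_proj (h : ChessRelations T₁ T₁' E₁ T₂ T₂' E₂) :
    (E₁ * E₂ + E₁ * E₂ - 1) * (E₁ * E₂) = E₁ * E₂ := by
  simp only [mul_add, add_mul, mul_sub, sub_mul, mul_assoc, h.idem₂, assoc_right h.comm,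
      assoc_right h.idem₁, mul_one, one_mul]
  abel

theorem pair_term (h : ChessRelations T₁ T₁' E₁ T₂ T₂' E₂) :
    (E₁ * T₁) * (E₂ * T₂) = E₁ * E₂ * (T₂ * T₁) := by
  calc (E₁ * T₁) * (E₂ * T₂) = E₁ * (T₁ * E₂) * T₂ := by noncomm_ring
    _ = E₁ * E₂ * (T₁ * T₂) := by rw [← h.comm₂₁]; noncomm_ring
    _ = _ := by rw [h.flux, ← mul_assoc, h.proj_mul_flux]

theorem pair_term_inv (h : ChessRelations T₁ T₁' E₁ T₂ T₂' E₂) :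
    (E₁ * T₁) * (T₂' * E₂) = T₂' * (E₁ * E₂) * T₁ := by
  calc (E₁ * T₁) * (T₂' * E₂) = E₁ * (T₁ * T₂') * E₂ := by noncomm_ring
    _ = (E₁ * T₂') * (E₁ * E₂ + E₁ * E₂ - 1) * (T₁ * E₂) := by
        rw [h.mul_inv_swap]; noncomm_ring
    _ = T₂' * ((E₁ * E₁) * E₂ + (E₁ * E₁) * E₂ - E₁) * E₂ * T₁ := by
        rw [h.comm₁₂', ← h.comm₂₁]; noncomm_ring
    _ = T₂' * (E₁ * (E₂ * E₂) + E₁ * (E₂ * E₂) - E₁ * E₂) * T₁ := by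
        rw [h.idem₁]; noncomm_ring
    _ = _ := by rw [h.idem₂]; noncomm_ring

theorem pair_mul_pair (h : ChessRelations T₁ T₁' E₁ T₂ T₂' E₂) :
    (E₁ * T₁ + T₁' * E₁) * (E₂ * T₂ + T₂' * E₂) = E₁ * E₂ * (T₂ * T₁) + T₂' * (E₁ * E₂) * T₁ +
      T₁' * (E₁ * E₂) * T₂ + T₁' * T₂' * (E₁ * E₂) := by
  have e1 : T₁' * E₁ * (T₂' * E₂) = T₁' * T₂' * (E₁ * E₂) := by
    rw [show T₁' * E₁ * (T₂' * E₂) = T₁' * (E₁ * T₂') * E₂ by noncomm_ring, h.comm₁₂']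
    noncomm_ring
  rw [add_mul, mul_add, mul_add, h.pair_term, h.pair_term_inv, e1]
  noncomm_ring

/-- The two reflections move a particle only around plaquettes whose lower left corner has both
coordinates even. Those have flux 0: the projection E₁E₂ absorbs the flux factor. -/
theorem pair_commute (h : ChessRelations T₁ T₁' E₁ T₂ T₂' E₂) :
    Commute (E₁ * T₁ + T₁' * E₁) (E₂ * T₂ + T₂' * E₂) := by
  show _ = _
  rw [h.pair_mul_pair, h.symm.pair_mul_pair, h.comm, h.flux, h.inv_mul_inv_swap,
    mul_assoc (T₁' * T₂') _ (E₁ * E₂), h.flux_mul_proj,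
    ← mul_assoc (E₁ * E₂) (E₁ * E₂ + E₁ * E₂ - 1), h.proj_mul_flux]
  abel

/-- A mixed product and its reverse cancel across a π plaquette and add up across a plaquette of
flux 0. The four surviving kinds of diagonal hop are those in `pair_mul_pair`, whence the factor 2.
-/
theorem sq_sum (h : ChessRelations T₁ T₁' E₁ T₂ T₂' E₂) :
    (T₁ + T₁' + T₂ + T₂') ^ 2 = 4 + (T₁ ^ 2 + T₁' ^ 2 + T₂ ^ 2 + T₂' ^ 2) +
      2 * ((E₁ * T₁ + T₁' * E₁) * (E₂ * T₂ + T₂' * E₂)) := by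
  have h4 : (4 : R) = 1 + 1 + 1 + 1 := by norm_num
  have h5 := h.symm.mul_inv_swap
  rw [h.comm] at h5
  rw [h.pair_mul_pair]
  simp only [pow_two, two_mul, mul_add, add_mul, h.inv₁, h.inv₁', h.inv₂, h.inv₂', h4]
  rw [h.flux, h.mul_inv_swap, h5, h.inv_mul_inv_swap]
  noncomm_ring

theorem proj_commute_sq (h : ChessRelations T₁ T₁' E₁ T₂ T₂' E₂) : Commute E₁ (T₁ ^ 2) := by
  show _ = _
  rw [pow_two]
  simp only [mul_add, add_mul, mul_sub, sub_mul, mul_assoc, h.shift₁, assoc_right h.shift₁]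
  abel

/-- The sign is the flux through a 2 × 1 rectangle: one 0 and one π in an even row, two π in an odd
row. -/
theorem mul_sq (h : ChessRelations T₁ T₁' E₁ T₂ T₂' E₂) :
    T₂ * T₁ ^ 2 = (1 - E₂ - E₂) * (T₁ ^ 2 * T₂) := by
  have e : (E₁ * E₂ + E₁ * E₂ - 1) * T₁ * (E₁ * E₂ + E₁ * E₂ - 1) = (1 - E₂ - E₂) * T₁ := by
    simp only [mul_add, add_mul, mul_sub, sub_mul, mul_assoc, h.shift₁, h.comm₂₁,
      assoc_right h.shift₁, assoc_right h.comm₂₁, assoc_right h.idem₁, assoc_right h.comm,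
      h.idem₂, one_mul, mul_one]
    abel
  calc T₂ * T₁ ^ 2 = (T₂ * T₁) * T₁ := by noncomm_ring
    _ = (E₁ * E₂ + E₁ * E₂ - 1) * (T₁ * T₂) * T₁ := by rw [← h.flux_symm]
    _ = (E₁ * E₂ + E₁ * E₂ - 1) * T₁ * (T₂ * T₁) := by noncomm_ring
    _ = ((E₁ * E₂ + E₁ * E₂ - 1) * T₁ * (E₁ * E₂ + E₁ * E₂ - 1)) * (T₁ * T₂) := by
        rw [h.flux_symm]; noncomm_ring
    _ = _ := by rw [e]; noncomm_ring

theorem proj₂_commute_sq (h : ChessRelations T₁ T₁' E₁ T₂ T₂' E₂) : Commute E₂ (T₁ ^ 2) :=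
  Commute.pow_right h.comm₂₁ 2

/-- Every 2 × 2 block contains one plaquette of flux 0 and three of flux π, so the doubled
translations form a π-flux system. -/
theorem sq_anticomm_sq (h : ChessRelations T₁ T₁' E₁ T₂ T₂' E₂) :
    T₁ ^ 2 * T₂ ^ 2 = -(T₂ ^ 2 * T₁ ^ 2) := by
  have e : T₂ * (1 - E₂ - E₂) * T₁ ^ 2 = -((1 - E₂ - E₂) * (T₂ * T₁ ^ 2)) := by
    have : (1 - E₂ - E₂) * T₂ = T₂ * (E₂ + E₂ - 1) := by
      simp only [mul_add, mul_sub, sub_mul, h.shift₂, one_mul, mul_one]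
      abel
    rw [← mul_assoc, this]; noncomm_ring
  have e2 : (1 - E₂ - E₂) * (1 - E₂ - E₂) = 1 := by
    simp only [mul_sub, sub_mul, h.idem₂, one_mul, mul_one]
    abel
  have : T₂ ^ 2 * T₁ ^ 2 = -(T₁ ^ 2 * T₂ ^ 2) := by
    calc T₂ ^ 2 * T₁ ^ 2 = T₂ * (T₂ * T₁ ^ 2) := by noncomm_ring
      _ = (T₂ * (1 - E₂ - E₂) * T₁ ^ 2) * T₂ := by rw [h.mul_sq]; noncomm_ring
      _ = -(((1 - E₂ - E₂) * (1 - E₂ - E₂)) * (T₁ ^ 2 * T₂ ^ 2)) := by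
          rw [e, h.mul_sq]; noncomm_ring
      _ = _ := by rw [e2, one_mul]
  rw [this, neg_neg]

/-- A 4 × 1 rectangle always contains an even number of π plaquettes; algebraically, the sign of
`mul_sq` appears twice. -/
theorem commute_pow_four (h : ChessRelations T₁ T₁' E₁ T₂ T₂' E₂) : Commute (T₁ ^ 4) T₂ := by
  have e2 : (1 - E₂ - E₂) * (1 - E₂ - E₂) = 1 := by
    simp only [mul_sub, sub_mul, h.idem₂, one_mul, mul_one]
    abel
  have e3 : T₁ ^ 2 * (1 - E₂ - E₂) = (1 - E₂ - E₂) * T₁ ^ 2 := by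
    have := h.proj₂_commute_sq.eq
    rw [mul_sub, mul_sub, sub_mul, sub_mul, this]; simp
  have : T₂ * T₁ ^ 4 = T₁ ^ 4 * T₂ := by
    calc T₂ * T₁ ^ 4 = (T₂ * T₁ ^ 2) * T₁ ^ 2 := by noncomm_ring
      _ = (1 - E₂ - E₂) * (T₁ ^ 2 * T₂) * T₁ ^ 2 := by rw [← h.mul_sq]
      _ = (1 - E₂ - E₂) * T₁ ^ 2 * (T₂ * T₁ ^ 2) := by noncomm_ring
      _ = (1 - E₂ - E₂) * (T₁ ^ 2 * (1 - E₂ - E₂)) * (T₁ ^ 2 * T₂) := by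
          rw [h.mul_sq]; noncomm_ring
      _ = ((1 - E₂ - E₂) * (1 - E₂ - E₂)) * (T₁ ^ 4 * T₂) := by rw [e3]; noncomm_ring
      _ = _ := by rw [e2, one_mul]
  exact this.symm

theorem sq_commute_pair₁ (h : ChessRelations T₁ T₁' E₁ T₂ T₂' E₂) :
    Commute (T₁ ^ 2) (E₁ * T₁ + T₁' * E₁) := by
  have c1 : Commute (T₁ ^ 2) T₁ := (Commute.refl T₁).pow_left 2
  have c2 : Commute (T₁ ^ 2) T₁' := by
    refine Commute.pow_left ?_ 2
    show _ = _
    rw [h.inv₁, h.inv₁']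
  have c3 := h.proj_commute_sq.symm
  exact (c3.mul_right c1).add_right (c2.mul_right c3)

/-- The second reflection crosses only even rows, where a 2 × 1 rectangle has flux π. -/
theorem sq_mul_pair₂ (h : ChessRelations T₁ T₁' E₁ T₂ T₂' E₂) :
    T₁ ^ 2 * (E₂ * T₂ + T₂' * E₂) = -((E₂ * T₂ + T₂' * E₂) * T₁ ^ 2) := by
  have e0 : E₂ * (1 - E₂ - E₂) = -E₂ := by
    simp only [mul_sub, h.idem₂, mul_one]; abel
  have e1 : E₂ * T₂ * T₁ ^ 2 = -(T₁ ^ 2 * (E₂ * T₂)) := by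
    calc E₂ * T₂ * T₁ ^ 2 = E₂ * (T₂ * T₁ ^ 2) := by noncomm_ring
      _ = (E₂ * (1 - E₂ - E₂)) * T₁ ^ 2 * T₂ := by rw [h.mul_sq]; noncomm_ring
      _ = -(E₂ * T₁ ^ 2 * T₂) := by rw [e0]; noncomm_ring
      _ = _ := by rw [h.proj₂_commute_sq.eq]; noncomm_ring
  have e2 : T₁ ^ 2 * (T₂' * E₂) = -(T₂' * E₂ * T₁ ^ 2) := by
    calc T₁ ^ 2 * (T₂' * E₂) = T₂' * (T₂ * T₁ ^ 2) * T₂' * E₂ := by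
          rw [show T₂' * (T₂ * T₁ ^ 2) * T₂' * E₂ = (T₂' * T₂) * T₁ ^ 2 * T₂' * E₂ by
            noncomm_ring, h.inv₂', one_mul, mul_assoc]
      _ = T₂' * (1 - E₂ - E₂) * T₁ ^ 2 * (T₂ * T₂') * E₂ := by rw [h.mul_sq]; noncomm_ring
      _ = T₂' * (1 - E₂ - E₂) * (T₁ ^ 2 * E₂) := by rw [h.inv₂]; noncomm_ring
      _ = T₂' * (E₂ - E₂ * E₂ - E₂ * E₂) * T₁ ^ 2 := by
          rw [← h.proj₂_commute_sq.eq]; noncomm_ring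
      _ = _ := by rw [h.idem₂]; noncomm_ring
  rw [mul_add, add_mul, e1, e2]
  noncomm_ring

theorem sq_mul_pairs (h : ChessRelations T₁ T₁' E₁ T₂ T₂' E₂) :
    T₁ ^ 2 * ((E₁ * T₁ + T₁' * E₁) * (E₂ * T₂ + T₂' * E₂)) =
      -((E₁ * T₁ + T₁' * E₁) * (E₂ * T₂ + T₂' * E₂) * T₁ ^ 2) := by
  rw [← mul_assoc, h.sq_commute_pair₁.eq, mul_assoc, h.sq_mul_pair₂]
  noncomm_ring

theorem anticomm_inv {a b c d : R} (hab : a * b = 1) (hba : b * a = 1)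
    (hac : a * c = -(d * a)) : b * d = -(c * b) := by
  calc b * d = -(b * (-(d * a)) * b) := by
        rw [show -(b * (-(d * a)) * b) = b * d * (a * b) by noncomm_ring, hab, mul_one]
    _ = -((b * a) * c * b) := by rw [← hac]; noncomm_ring
    _ = _ := by rw [hba, one_mul]

theorem inv_sq_mul_inv_sq {a b : R} (hab : a * b = 1) : a ^ 2 * b ^ 2 = 1 := by
  rw [show a ^ 2 * b ^ 2 = a * (a * b) * b by noncomm_ring, hab, mul_one, hab]

theorem sq_relations (h : ChessRelations T₁ T₁' E₁ T₂ T₂' E₂) :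
    PiFluxRelations (T₁ ^ 2) (T₁' ^ 2) (T₂ ^ 2) (T₂' ^ 2) :=
  ⟨inv_sq_mul_inv_sq h.inv₁, inv_sq_mul_inv_sq h.inv₁', inv_sq_mul_inv_sq h.inv₂,
    inv_sq_mul_inv_sq h.inv₂', h.sq_anticomm_sq⟩

/-- The shifted square is D + 2Q with Q² = 1 and DQ = -QD, so its square is D² + 4. Since D is
itself a π-flux sum, D² is known from `PiFluxRelations.sq_sum`. -/
theorem sq_sum_sq (h : ChessRelations T₁ T₁' E₁ T₂ T₂' E₂) :
    ((T₁ + T₁' + T₂ + T₂') ^ 2 - 4) ^ 2 = 8 + T₁ ^ 4 + T₁' ^ 4 + T₂ ^ 4 + T₂' ^ 4 := by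
  have hD := h.sq_relations.sq_sum
  simp only [← pow_mul] at hD
  norm_num at hD
  set D := T₁ ^ 2 + T₁' ^ 2 + T₂ ^ 2 + T₂' ^ 2 with hDdef
  set Q := (E₁ * T₁ + T₁' * E₁) * (E₂ * T₂ + T₂' * E₂) with hQ
  have hQQ : Q * Q = 1 := by
    calc Q * Q = (E₁ * T₁ + T₁' * E₁) * ((E₂ * T₂ + T₂' * E₂) * (E₁ * T₁ + T₁' * E₁)) *
        (E₂ * T₂ + T₂' * E₂) := by rw [hQ]; noncomm_ring
      _ = ((E₁ * T₁ + T₁' * E₁) * (E₁ * T₁ + T₁' * E₁)) *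
        ((E₂ * T₂ + T₂' * E₂) * (E₂ * T₂ + T₂' * E₂)) := by
          rw [← h.pair_commute.eq]; noncomm_ring
      _ = 1 := by rw [h.pair_sq, h.symm.pair_sq, one_mul]
  have a1 : T₁ ^ 2 * Q = -(Q * T₁ ^ 2) := h.sq_mul_pairs
  have a2 : T₂ ^ 2 * Q = -(Q * T₂ ^ 2) := by
    have := h.symm.sq_mul_pairs
    rwa [← h.pair_commute.eq] at this
  have a3 := anticomm_inv (inv_sq_mul_inv_sq h.inv₁) (inv_sq_mul_inv_sq h.inv₁') a1
  have a4 := anticomm_inv (inv_sq_mul_inv_sq h.inv₂) (inv_sq_mul_inv_sq h.inv₂') a2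
  have hDQ : D * Q = -(Q * D) := by
    rw [hDdef]
    simp only [mul_add, add_mul, a1, a2, a3, a4]
    abel
  rw [h.sq_sum]
  calc (4 + D + 2 * Q - 4) ^ 2 = D ^ 2 + (D * Q + D * Q) + (Q * D + Q * D) + 4 * (Q * Q) := by
        noncomm_ring
    _ = D ^ 2 + 4 := by rw [hQQ, hDQ, mul_one]; abel
    _ = _ := by
        rw [hD, show (8 : R) = 4 + 4 by norm_num]
        abel

/-- An element anticommuting with the first reflection and with all `T ^ 2`, and commuting with
the second reflection, reverses the sign of the shifted square. -/
theorem anticomm_sq_sum (h : ChessRelations T₁ T₁' E₁ T₂ T₂' E₂) {X : R}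
    (hQ₁ : X * (E₁ * T₁ + T₁' * E₁) = -((E₁ * T₁ + T₁' * E₁) * X))
    (hQ₂ : X * (E₂ * T₂ + T₂' * E₂) = (E₂ * T₂ + T₂' * E₂) * X)
    (h₁ : X * T₁ ^ 2 = -(T₁ ^ 2 * X)) (h₂ : X * T₂ ^ 2 = -(T₂ ^ 2 * X)) :
    X * ((T₁ + T₁' + T₂ + T₂') ^ 2 - 4) = -(((T₁ + T₁' + T₂ + T₂') ^ 2 - 4) * X) := by
  have h₁' : T₁ ^ 2 * X = -(X * T₁ ^ 2) := by rw [h₁, neg_neg]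
  have h₂' : T₂ ^ 2 * X = -(X * T₂ ^ 2) := by rw [h₂, neg_neg]
  have a3 := anticomm_inv (inv_sq_mul_inv_sq h.inv₁) (inv_sq_mul_inv_sq h.inv₁') h₁'
  have a4 := anticomm_inv (inv_sq_mul_inv_sq h.inv₂) (inv_sq_mul_inv_sq h.inv₂') h₂'
  have hQ : X * ((E₁ * T₁ + T₁' * E₁) * (E₂ * T₂ + T₂' * E₂)) =
      -((E₁ * T₁ + T₁' * E₁) * (E₂ * T₂ + T₂' * E₂) * X) := by
    rw [← mul_assoc, hQ₁, neg_mul, mul_assoc, hQ₂, mul_assoc]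
  rw [h.sq_sum]
  generalize (E₁ * T₁ + T₁' * E₁) * (E₂ * T₂ + T₂' * E₂) = Q at hQ ⊢
  rw [add_assoc, add_sub_cancel_left]
  simp only [two_mul, mul_add, add_mul, a3, a4, h₁', h₂', hQ, neg_neg]
  abel

end ChessRelations

end FluxAlgebra

end

/-! ### Weighted shifts, the hopping matrix and its symmetries -/

section

open Matrix

set_option linter.unusedSectionVars false
set_option linter.unusedSimpArgs false

variable {L : ℕ} [NeZero L]

/-- The weighted shift `(S f)(x) = w(x) f(x + d)` on functions on the sites. -/
def shiftMat (d : Site L) (w : Site L → ℂ) : Matrix (Site L) (Site L) ℂ :=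
  Matrix.of fun x y => if y = x + d then w x else 0

theorem shiftMat_apply (d : Site L) (w : Site L → ℂ) (x y : Site L) :
    shiftMat d w x y = if y = x + d then w x else 0 := rfl

theorem shiftMat_mul (d d' : Site L) (w w' : Site L → ℂ) :
    shiftMat d w * shiftMat d' w' = shiftMat (d + d') fun x => w x * w' (x + d) := by
  ext x y
  rw [mul_apply, Finset.sum_eq_single (x + d)]
  · simp [shiftMat_apply, add_assoc]
  · intro z _ hz
    rw [shiftMat_apply, if_neg hz, zero_mul]
  · simp

theorem diagonal_eq_shiftMat (w : Site L → ℂ) : diagonal w = shiftMat 0 w := by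
  ext x y
  simp [shiftMat_apply, diagonal_apply, eq_comm]

theorem one_eq_shiftMat : (1 : Matrix (Site L) (Site L) ℂ) = shiftMat 0 fun _ => 1 := by
  rw [← diagonal_eq_shiftMat]; exact diagonal_one.symm

theorem shiftMat_add (d : Site L) (w w' : Site L → ℂ) :
    shiftMat d w + shiftMat d w' = shiftMat d fun x => w x + w' x := by
  ext x y
  simp only [Matrix.add_apply, shiftMat_apply]
  split_ifs <;> simp

theorem shiftMat_neg (d : Site L) (w : Site L → ℂ) :
    -shiftMat d w = shiftMat d fun x => -w x := by
  ext x y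
  simp only [Matrix.neg_apply, shiftMat_apply]
  split_ifs <;> simp

theorem shiftMat_congr {d d' : Site L} {w w' : Site L → ℂ} (hd : d = d') (hw : ∀ x, w x = w' x) :
    shiftMat d w = shiftMat d' w' := by
  rw [hd, funext hw]

theorem conjTranspose_shiftMat (d : Site L) (w : Site L → ℂ) :
    (shiftMat d w)ᴴ = shiftMat (-d) fun x => star (w (x - d)) := by
  ext x y
  rw [conjTranspose_apply, shiftMat_apply, shiftMat_apply]
  by_cases h : x = y + d
  · subst h; simp
  · rw [if_neg h, if_neg, star_zero]
    rintro rfl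
    exact h (by simp)

theorem shiftMat_pow (d : Site L) (w : Site L → ℂ) (m : ℕ) :
    shiftMat d w ^ m = shiftMat (m • d) fun x => ∏ i ∈ Finset.range m, w (x + i • d) := by
  induction m with
  | zero => simp [one_eq_shiftMat]
  | succ m ih =>
    rw [pow_succ, ih, shiftMat_mul]
    refine shiftMat_congr (by rw [succ_nsmul]) fun x => ?_
    rw [Finset.prod_range_succ]

theorem trace_shiftMat {d : Site L} (hd : d ≠ 0) (w : Site L → ℂ) : trace (shiftMat d w) = 0 := by
  refine Finset.sum_eq_zero fun x _ => ?_
  rw [diag_apply, shiftMat_apply, if_neg]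
  intro h
  exact hd (left_eq_add.mp h)

/-- The magnetic translation in direction `μ`. -/
def magTrans (σ : GaugeField L) (μ : Fin 2) : Matrix (Site L) (Site L) ℂ :=
  shiftMat (unitVec L μ) fun x => ((σ (x, μ) : ℤ) : ℂ)

/-- The hopping matrix, i.e. the one-particle Hamiltonian without the factor `-t`. -/
def hopMat (σ : GaugeField L) : Matrix (Site L) (Site L) ℂ :=
  magTrans σ 0 + (magTrans σ 0)ᴴ + magTrans σ 1 + (magTrans σ 1)ᴴ

theorem isHermitian_hopMat (σ : GaugeField L) : (hopMat σ).IsHermitian := by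
  unfold IsHermitian hopMat
  simp only [conjTranspose_add, conjTranspose_conjTranspose]
  abel

theorem intUnit_mul_self (u : ℤˣ) : ((u : ℤ) : ℂ) * ((u : ℤ) : ℂ) = 1 := by
  rcases Int.units_eq_one_or u with rfl | rfl <;> simp

theorem star_intUnit (u : ℤˣ) : star ((u : ℤ) : ℂ) = ((u : ℤ) : ℂ) := by
  rcases Int.units_eq_one_or u with rfl | rfl <;> simp

theorem conjTranspose_magTrans (σ : GaugeField L) (μ : Fin 2) :
    (magTrans σ μ)ᴴ =
      shiftMat (-unitVec L μ) fun x => ((σ (x - unitVec L μ, μ) : ℤ) : ℂ) := by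
  rw [magTrans, conjTranspose_shiftMat]
  simp only [star_intUnit]

theorem magTrans_mul_conjTranspose (σ : GaugeField L) (μ : Fin 2) :
    magTrans σ μ * (magTrans σ μ)ᴴ = 1 := by
  rw [conjTranspose_magTrans, magTrans, shiftMat_mul, one_eq_shiftMat]
  refine shiftMat_congr (add_neg_cancel _) fun x => ?_
  rw [add_sub_cancel_right, intUnit_mul_self]

theorem conjTranspose_mul_magTrans (σ : GaugeField L) (μ : Fin 2) :
    (magTrans σ μ)ᴴ * magTrans σ μ = 1 := by
  rw [conjTranspose_magTrans, magTrans, shiftMat_mul, one_eq_shiftMat]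
  refine shiftMat_congr (neg_add_cancel _) fun x => ?_
  rw [← sub_eq_add_neg, intUnit_mul_self]

/-- The two paths from x to its diagonal neighbour differ by the spins around the plaquette they
enclose, because spins square to 1. That plaquette has lower left corner x, hence the label x + e₁ +
e₂. -/
theorem magTrans_flux (σ : GaugeField L) :
    magTrans σ 0 * magTrans σ 1 =
      diagonal (fun x => ((plaquetteFlux σ (x + unitVec L 0 + unitVec L 1) : ℤ) : ℂ)) *
        (magTrans σ 1 * magTrans σ 0) := by
  rw [magTrans, magTrans, diagonal_eq_shiftMat, shiftMat_mul, shiftMat_mul, shiftMat_mul]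
  refine shiftMat_congr (by abel) fun x => ?_
  have h2 : x + unitVec L 0 + unitVec L 1 - unitVec L 1 = x + unitVec L 0 := by abel
  have h3 : x + unitVec L 0 + unitVec L 1 - unitVec L 0 = x + unitVec L 1 := by abel
  simp only [plaquetteFlux, h2, h3, add_zero, add_sub_cancel_right]
  push_cast
  linear_combination (-((σ (x, 0) : ℤ) : ℂ) * ((σ (x + unitVec L 0, 1) : ℤ) : ℂ)) *
    (((σ (x + unitVec L 1, 0) : ℤ) : ℂ) * ((σ (x + unitVec L 1, 0) : ℤ) : ℂ) *
      intUnit_mul_self (σ (x, 1)) + intUnit_mul_self (σ (x + unitVec L 1, 0)))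

/-- The second-quantized Hamiltonian in terms of the hopping matrix. -/
theorem matterHamiltonian_eq (t : ℝ) (σ : GaugeField L) :
    matterHamiltonian t σ = -((t : ℂ) •
      ∑ x, ∑ y, hopMat σ x y • ((annihilate x)ᴴ * annihilate y)) := by
  have h1 : ∀ μ, ∑ x, ∑ y, magTrans σ μ x y • ((annihilate x)ᴴ * annihilate y) =
      ∑ x, hop σ x μ := by
    intro μ
    refine Finset.sum_congr rfl fun x _ => ?_
    rw [Finset.sum_eq_single (x + unitVec L μ)]
    · rw [magTrans, shiftMat_apply, if_pos rfl, hop, create]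
    · intro y _ hy
      rw [magTrans, shiftMat_apply, if_neg hy, zero_smul]
    · simp
  have h2 : ∀ μ, ∑ x, ∑ y, (magTrans σ μ)ᴴ x y • ((annihilate x)ᴴ * annihilate y) =
      ∑ x, (hop σ x μ)ᴴ := by
    intro μ
    rw [← conjTranspose_sum, ← h1, Finset.sum_comm]
    simp only [conjTranspose_sum, conjTranspose_smul, conjTranspose_mul,
      conjTranspose_conjTranspose, conjTranspose_apply]
  unfold matterHamiltonian hopMat
  simp only [Matrix.add_apply, add_smul, Finset.sum_add_distrib, h1, h2, Fin.sum_univ_two]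
  congr 2
  abel

/-- The partition function as a product over the eigenvalues of the hopping matrix. -/
theorem partitionOf_eq (s : ℤˣ) (t β : ℝ) (σ : GaugeField L) :
    partitionOf s t β σ =
      ∏ k, (1 + ((s : ℤ) : ℝ) * Real.exp (β * t * (isHermitian_hopMat σ).eigenvalues k)) := by
  rw [partitionOf, matterHamiltonian_eq, trace_sign_exp s t β (isHermitian_hopMat σ),
    Complex.ofReal_re]

theorem translation_invariant {α : Type*} {w : Site L → α}
    (h : ∀ μ x, w (x + unitVec L μ) = w x) (x : Site L) : w x = w 0 := by
  have h2 : ∀ μ (n : ℕ) x, w (x + n • unitVec L μ) = w x := by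
    intro μ n
    induction n with
    | zero => simp
    | succ n ih => intro x; rw [succ_nsmul, ← add_assoc, h, ih]
  have hx : x = 0 + x.1.val • unitVec L 0 + x.2.val • unitVec L 1 := by
    ext <;> simp [unitVec]
  rw [hx, h2, h2]

theorem prod_zmod {α : Type*} [CommMonoid α] (f : ZMod L → α) :
    ∏ i : ZMod L, f i = ∏ i ∈ Finset.range L, f i :=
  Finset.prod_nbij' ZMod.val (fun i => (i : ZMod L))
    (fun i _ => Finset.mem_range.mpr (ZMod.val_lt i)) (fun _ _ => Finset.mem_univ _)
    (fun i _ => ZMod.natCast_zmod_val i)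
    (fun i hi => ZMod.val_cast_of_lt (Finset.mem_range.mp hi)) (fun i _ => by simp)

/-- The product of the spins along the loop through the origin in direction `μ`. -/
def loopFlux (σ : GaugeField L) (μ : Fin 2) : ℤˣ := if μ = 0 then loopFluxH σ else loopFluxV σ

theorem loopFlux_eq (σ : GaugeField L) (μ : Fin 2) :
    loopFlux σ μ = ∏ i ∈ Finset.range L, σ (i • unitVec L μ, μ) := by
  fin_cases μ
  · simp [loopFlux, loopFluxH, prod_zmod, unitVec]
  · simp [loopFlux, loopFluxV, prod_zmod, unitVec]

theorem nsmul_unitVec (μ : Fin 2) : L • unitVec L μ = 0 := by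
  fin_cases μ <;> ext <;> simp [unitVec]

/-- If it commutes with all magnetic translations, the `L`-th power of a magnetic translation is
the scalar given by the loop flux. -/
theorem magTrans_pow (σ : GaugeField L) (μ : Fin 2)
    (h : ∀ ν, Commute (magTrans σ μ ^ L) (magTrans σ ν)) :
    magTrans σ μ ^ L = ((loopFlux σ μ : ℤ) : ℂ) • 1 := by
  set w : Site L → ℂ := fun x => ∏ i ∈ Finset.range L, ((σ (x + i • unitVec L μ, μ) : ℤ) : ℂ)
  have hT : magTrans σ μ ^ L = shiftMat 0 w := by
    rw [magTrans, shiftMat_pow, nsmul_unitVec]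
  -- The L-th power multiplies by the spin product of the straight loop through each site.
  -- Commutation with the translations makes this product independent of the site, so its value at
  -- the origin decides.
  have hw : ∀ ν x, w (x + unitVec L ν) = w x := by
    intro ν x
    have h1 := congrFun (congrFun (h ν).eq x) (x + unitVec L ν)
    rw [hT, magTrans, shiftMat_mul, shiftMat_mul, shiftMat_apply, shiftMat_apply,
      if_pos (by rw [zero_add]), if_pos (by rw [add_zero]), add_zero] at h1
    have h2 := intUnit_mul_self (σ (x, ν))
    linear_combination (-((σ (x, ν) : ℤ) : ℂ)) * h1 + (w x - w (x + unitVec L ν)) * h2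
  rw [hT, one_eq_shiftMat]
  ext x y
  simp only [Matrix.smul_apply, shiftMat_apply, smul_eq_mul, mul_ite, mul_one, mul_zero]
  rw [translation_invariant hw x, loopFlux_eq]
  simp [w]

/-- The product shifts by (i, j), so it has no diagonal entries unless this shift is zero modulo L.
-/
theorem trace_magTrans_pow_mul_pow (σ : GaugeField L) {i j : ℕ} (h : ¬ (L ∣ i ∧ L ∣ j)) :
    trace (magTrans σ 0 ^ i * magTrans σ 1 ^ j) = 0 := by
  rw [magTrans, magTrans, shiftMat_pow, shiftMat_pow, shiftMat_mul]
  refine trace_shiftMat (fun h0 => h ?_) _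
  have h1 := congrArg Prod.fst h0
  have h2 := congrArg Prod.snd h0
  simp [unitVec] at h1 h2
  exact ⟨(ZMod.natCast_eq_zero_iff _ _).mp h1, (ZMod.natCast_eq_zero_iff _ _).mp h2⟩

/-- An odd power of a matrix has trace zero if an involution reverses its sign. -/
theorem trace_odd_pow {ι : Type*} [Fintype ι] [DecidableEq ι] {X M : Matrix ι ι ℂ}
    (hX : X * X = 1) (hM : X * M = -(M * X)) {n : ℕ} (hn : Odd n) : trace (M ^ n) = 0 := by
  have h1 : ∀ m : ℕ, X * M ^ m = (-1 : ℂ) ^ m • (M ^ m * X) := by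
    intro m
    induction m with
    | zero => simp
    | succ m ih =>
      rw [pow_succ M, ← mul_assoc, ih, smul_mul_assoc, mul_assoc, hM, mul_neg, ← mul_assoc,
        pow_succ (-1 : ℂ), mul_neg_one, neg_smul, smul_neg]
  have h2 : trace (M ^ n) = - trace (M ^ n) := by
    calc trace (M ^ n) = trace (X * (X * M ^ n)) := by rw [← mul_assoc, hX, one_mul]
      _ = trace (X * M ^ n * X) := by rw [trace_mul_comm]
      _ = - trace (M ^ n * (X * X)) := by
        rw [h1, hn.neg_one_pow, neg_one_smul, neg_mul, trace_neg, mul_assoc]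
      _ = _ := by rw [hX, mul_one]
  linear_combination h2 / 2

section Parity

/-- Reduction of a coordinate modulo `4`. -/
def mod4 (h4 : 4 ∣ L) (i : ZMod L) : ZMod 4 := ZMod.castHom h4 (ZMod 4) i

theorem mod4_add_one (h4 : 4 ∣ L) (i : ZMod L) : mod4 h4 (i + 1) = mod4 h4 i + 1 := by
  rw [mod4, map_add, map_one]; rfl

theorem mod4_sub_one (h4 : 4 ∣ L) (i : ZMod L) : mod4 h4 (i - 1) = mod4 h4 i - 1 := by
  rw [mod4, map_sub, map_one]; rfl

/-- As 4 ∣ L, parity is visible in `ZMod 4`, where claims about neighbouring sites become finite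
checks. -/
theorem odd_val_iff (h4 : 4 ∣ L) (i : ZMod L) :
    Odd i.val ↔ mod4 h4 i = 1 ∨ mod4 h4 i = 3 := by
  have h1 : mod4 h4 i = ((i.val % 4 : ℕ) : ZMod 4) := by
    rw [ZMod.natCast_mod, mod4, ZMod.castHom_apply, ZMod.natCast_val]
  rw [h1, Nat.odd_iff, ← Nat.mod_mod_of_dvd i.val (show 2 ∣ 4 by norm_num)]
  have h2 : i.val % 4 < 4 := Nat.mod_lt _ (by norm_num)
  generalize i.val % 4 = n at h2 ⊢
  interval_cases n <;> decide

/-- Coordinate `μ` of a site modulo `4`. -/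
def coord4 (h4 : 4 ∣ L) (x : Site L) (μ : Fin 2) : ZMod 4 :=
  mod4 h4 (if μ = 0 then x.1 else x.2)

theorem coord4_add (h4 : 4 ∣ L) (x : Site L) (μ ν : Fin 2) :
    coord4 h4 (x + unitVec L μ) ν = coord4 h4 x ν + if μ = ν then 1 else 0 := by
  fin_cases μ <;> fin_cases ν <;> simp [coord4, unitVec, mod4_add_one]

theorem coord4_sub (h4 : 4 ∣ L) (x : Site L) (μ ν : Fin 2) :
    coord4 h4 (x - unitVec L μ) ν = coord4 h4 x ν - if μ = ν then 1 else 0 := by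
  fin_cases μ <;> fin_cases ν <;> simp [coord4, unitVec, mod4_sub_one]

/-- The projection on the sites whose coordinate `μ` is even. -/
def evenProj (h4 : 4 ∣ L) (μ : Fin 2) : Matrix (Site L) (Site L) ℂ :=
  shiftMat 0 fun x => if coord4 h4 x μ = 0 ∨ coord4 h4 x μ = 2 then 1 else 0

theorem evenProj_idem (h4 : 4 ∣ L) (μ : Fin 2) :
    evenProj h4 μ * evenProj h4 μ = evenProj h4 μ := by
  rw [evenProj, shiftMat_mul]
  refine shiftMat_congr (add_zero _) fun x => ?_
  simp

theorem evenProj_comm (h4 : 4 ∣ L) (μ ν : Fin 2) :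
    evenProj h4 μ * evenProj h4 ν = evenProj h4 ν * evenProj h4 μ := by
  rw [evenProj, evenProj, shiftMat_mul, shiftMat_mul]
  refine shiftMat_congr rfl fun x => ?_
  simp only [add_zero]
  rw [mul_comm]

theorem evenProj_shift (h4 : 4 ∣ L) (σ : GaugeField L) (μ : Fin 2) :
    evenProj h4 μ * magTrans σ μ = magTrans σ μ - magTrans σ μ * evenProj h4 μ := by
  rw [eq_sub_iff_add_eq, evenProj, magTrans, shiftMat_mul, shiftMat_mul, zero_add, add_zero,
    shiftMat_add]
  refine shiftMat_congr rfl fun x => ?_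
  rw [coord4_add, if_pos rfl, add_zero]
  generalize coord4 h4 x μ = a
  revert a
  have : ∀ a : ZMod 4, (a = 0 ∨ a = 2) ↔ ¬ (a + 1 = 0 ∨ a + 1 = 2) := by decide
  intro a
  by_cases h : a + 1 = 0 ∨ a + 1 = 2
  · rw [if_pos h, if_neg (by rw [this]; exact not_not.mpr h)]; ring
  · rw [if_neg h, if_pos ((this a).mpr h)]; ring

theorem evenProj_comm_shift (h4 : 4 ∣ L) (σ : GaugeField L) {μ ν : Fin 2} (h : μ ≠ ν) :
    evenProj h4 μ * magTrans σ ν = magTrans σ ν * evenProj h4 μ := by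
  rw [evenProj, magTrans, shiftMat_mul, shiftMat_mul, zero_add, add_zero]
  refine shiftMat_congr rfl fun x => ?_
  rw [coord4_add, if_neg h.symm, add_zero, add_zero, mul_comm]

/-- The plaquette with lower left corner x has an upper right corner with both coordinates odd
exactly when those of x are both even. Hence the flux is 2E₁E₂ - 1 as a multiplication operator. -/
theorem chessRelations (h4 : 4 ∣ L) {σ : GaugeField L}
    (hσ : ∀ p, plaquetteFlux σ p = chessFlux L p) :
    ChessRelations (magTrans σ 0) (magTrans σ 0)ᴴ (evenProj h4 0)
      (magTrans σ 1) (magTrans σ 1)ᴴ (evenProj h4 1) := by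
  refine ⟨magTrans_mul_conjTranspose σ 0, conjTranspose_mul_magTrans σ 0,
    magTrans_mul_conjTranspose σ 1, conjTranspose_mul_magTrans σ 1, evenProj_idem h4 0,
    evenProj_idem h4 1, evenProj_comm h4 1 0, evenProj_shift h4 σ 0, evenProj_shift h4 σ 1,
    evenProj_comm_shift h4 σ (by decide), evenProj_comm_shift h4 σ (by decide), ?_⟩
  rw [magTrans_flux]
  congr 1
  rw [diagonal_eq_shiftMat, evenProj, evenProj, shiftMat_mul, one_eq_shiftMat, shiftMat_add,
    add_zero, sub_eq_add_neg, shiftMat_neg, shiftMat_add]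
  refine shiftMat_congr rfl fun x => ?_
  rw [hσ, chessFlux]
  have h0 : mod4 h4 (x + unitVec L 0 + unitVec L 1).1 = coord4 h4 x 0 + 1 := by
    simp [coord4, unitVec, mod4_add_one]
  have h1 : mod4 h4 (x + unitVec L 0 + unitVec L 1).2 = coord4 h4 x 1 + 1 := by
    simp [coord4, unitVec, mod4_add_one]
  have : ∀ a : ZMod 4, (a + 1 = 1 ∨ a + 1 = 3) ↔ (a = 0 ∨ a = 2) := by decide
  simp only [odd_val_iff h4, h0, h1, this, add_zero]
  by_cases ha : coord4 h4 x 0 = 0 ∨ coord4 h4 x 0 = 2 <;>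
    by_cases hb : coord4 h4 x 1 = 0 ∨ coord4 h4 x 1 = 2 <;> simp [ha, hb]

theorem piFluxRelations {σ : GaugeField L} (hσ : ∀ p, plaquetteFlux σ p = piFlux L p) :
    PiFluxRelations (magTrans σ 0) (magTrans σ 0)ᴴ (magTrans σ 1) (magTrans σ 1)ᴴ := by
  refine ⟨magTrans_mul_conjTranspose σ 0, conjTranspose_mul_magTrans σ 0,
    magTrans_mul_conjTranspose σ 1, conjTranspose_mul_magTrans σ 1, ?_⟩
  rw [magTrans_flux]
  simp only [hσ, piFlux]
  rw [show (fun _ : Site L => (((-1 : ℤˣ) : ℤ) : ℂ)) = fun _ => -1 by simp,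
    show (diagonal fun _ : Site L => (-1 : ℂ)) = -1 by
      ext x y; by_cases h : x = y <;> simp [h], neg_one_mul]

/-- The multiplication operator by a sign depending on the coordinates modulo `4`. -/
def signMat (h4 : 4 ∣ L) (f g : ZMod 4 → ℤ) : Matrix (Site L) (Site L) ℂ :=
  shiftMat 0 fun x => (f (coord4 h4 x 0) : ℂ) * (g (coord4 h4 x 1) : ℂ)

theorem signMat_mul_self (h4 : 4 ∣ L) {f g : ZMod 4 → ℤ} (hf : ∀ a, f a * f a = 1)
    (hg : ∀ a, g a * g a = 1) : signMat h4 f g * signMat h4 f g = 1 := by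
  rw [signMat, shiftMat_mul, one_eq_shiftMat]
  refine shiftMat_congr (add_zero _) fun x => ?_
  rw [add_zero]
  have h1 := hf (coord4 h4 x 0)
  have h2 := hg (coord4 h4 x 1)
  have h1' : (f (coord4 h4 x 0) : ℂ) * f (coord4 h4 x 0) = 1 := by exact_mod_cast h1
  have h2' : (g (coord4 h4 x 1) : ℂ) * g (coord4 h4 x 1) = 1 := by exact_mod_cast h2
  linear_combination (g (coord4 h4 x 1) : ℂ) * g (coord4 h4 x 1) * h1' + h2'

/-- The sublattice sign (-1)^(x₁ + x₂) anticommutes with every hop. -/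
theorem trace_hopMat_odd (h4 : 4 ∣ L) (σ : GaugeField L) {n : ℕ} (hn : Odd n) :
    trace (hopMat σ ^ n) = 0 := by
  set f : ZMod 4 → ℤ := fun a => if a = 0 ∨ a = 2 then 1 else -1 with hf
  have hff : ∀ a, f a * f a = 1 := by intro a; simp only [hf]; split_ifs <;> simp
  have hf1 : ∀ a, f (a + 1) = - f a := by rw [hf]; decide
  have hf2 : ∀ a, f (a - 1) = - f a := by rw [hf]; decide
  refine trace_odd_pow (signMat_mul_self h4 hff hff) ?_ hn
  have h1 : ∀ μ, signMat h4 f f * magTrans σ μ = -(magTrans σ μ * signMat h4 f f) := by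
    intro μ
    rw [signMat, magTrans, shiftMat_mul, shiftMat_mul, shiftMat_neg]
    refine shiftMat_congr (by abel) fun x => ?_
    rw [coord4_add, coord4_add, add_zero]
    fin_cases μ <;> simp [hf1] <;> ring
  have h2 : ∀ μ, signMat h4 f f * (magTrans σ μ)ᴴ = -((magTrans σ μ)ᴴ * signMat h4 f f) := by
    intro μ
    rw [signMat, conjTranspose_magTrans, shiftMat_mul, shiftMat_mul, shiftMat_neg]
    refine shiftMat_congr (by abel) fun x => ?_
    rw [← sub_eq_add_neg x, coord4_sub, coord4_sub, add_zero]
    fin_cases μ <;> simp [hf2] <;> ring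
  unfold hopMat
  simp only [mul_add, add_mul, h1, h2]
  abel

theorem trace_hopMat_sq_odd (h4 : 4 ∣ L) {σ : GaugeField L}
    (hσ : ∀ p, plaquetteFlux σ p = chessFlux L p) {n : ℕ} (hn : Odd n) :
    trace ((hopMat σ ^ 2 - 4) ^ n) = 0 := by
  -- The sign f(x₁) g(x₂) has to reverse D and Q. Both patterns flip under a shift by two, which
  -- reverses the squared translations. Inside the pairs {0, 1} and {2, 3}, f flips, so the first
  -- reflection anticommutes, and g is constant, so the second one commutes.
  set f : ZMod 4 → ℤ := fun a => if a = 0 ∨ a = 3 then 1 else -1 with hf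
  set g : ZMod 4 → ℤ := fun a => if a = 0 ∨ a = 1 then 1 else -1 with hg
  have hff : ∀ a, f a * f a = 1 := by intro a; simp only [hf]; split_ifs <;> simp
  have hgg : ∀ a, g a * g a = 1 := by intro a; simp only [hg]; split_ifs <;> simp
  have hf1 : ∀ a, (a = 0 ∨ a = 2) → f (a + 1) = - f a := by rw [hf]; decide
  have hf2 : ∀ a, (a - 1 = 0 ∨ a - 1 = 2) → f (a - 1) = - f a := by rw [hf]; decide
  have hg1 : ∀ a, (a = 0 ∨ a = 2) → g (a + 1) = g a := by rw [hg]; decide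
  have hg2 : ∀ a, (a - 1 = 0 ∨ a - 1 = 2) → g (a - 1) = g a := by rw [hg]; decide
  have hf3 : ∀ a, f (a + 1 + 1) = - f a := by rw [hf]; decide
  have hg3 : ∀ a, g (a + 1 + 1) = - g a := by rw [hg]; decide
  refine trace_odd_pow (signMat_mul_self h4 hff hgg) ?_ hn
  refine (chessRelations h4 hσ).anticomm_sq_sum ?_ ?_ ?_ ?_
  · rw [conjTranspose_magTrans, signMat, evenProj, magTrans]
    simp only [shiftMat_mul, mul_add, add_mul, neg_add, shiftMat_neg]
    congr 1
    · refine shiftMat_congr (by abel) fun x => ?_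
      simp only [zero_add, add_zero, coord4_add]
      by_cases h : coord4 h4 x 0 = 0 ∨ coord4 h4 x 0 = 2
      · simp [h, hf1 _ h]; ring
      · simp [h]
    · refine shiftMat_congr (by abel) fun x => ?_
      simp only [zero_add, add_zero, ← sub_eq_add_neg x, coord4_sub]
      by_cases h : coord4 h4 x 0 - 1 = 0 ∨ coord4 h4 x 0 - 1 = 2
      · simp [h, hf2 _ h]; ring
      · simp [h]
  · rw [conjTranspose_magTrans, signMat, evenProj, magTrans]
    simp only [shiftMat_mul, mul_add, add_mul]
    congr 1
    · refine shiftMat_congr (by abel) fun x => ?_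
      simp only [zero_add, add_zero, coord4_add]
      by_cases h : coord4 h4 x 1 = 0 ∨ coord4 h4 x 1 = 2
      · simp [h, hg1 _ h]; ring
      · simp [h]
    · refine shiftMat_congr (by abel) fun x => ?_
      simp only [zero_add, add_zero, ← sub_eq_add_neg x, coord4_sub]
      by_cases h : coord4 h4 x 1 - 1 = 0 ∨ coord4 h4 x 1 - 1 = 2
      · simp [h, hg2 _ h]; ring
      · simp [h]
  · rw [signMat, magTrans, pow_two]
    simp only [shiftMat_mul, shiftMat_neg]
    refine shiftMat_congr (by abel) fun x => ?_
    simp only [add_zero, ← add_assoc, coord4_add]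
    simp [hf3]; ring
  · rw [signMat, magTrans, pow_two]
    simp only [shiftMat_mul, shiftMat_neg]
    refine shiftMat_congr (by abel) fun x => ?_
    simp only [add_zero, ← add_assoc, coord4_add]
    simp [hg3]; ring

end Parity

end

/-! ### Moments, spectral traces and twisted roots of unity -/

section

open Matrix

/-- Two weighted families of reals with equal moments have equal sums of every function. -/
theorem sum_eq_of_moments {I J : Type*} (s : Finset I) (t : Finset J) (x : I → ℝ) (y : J → ℝ)
    (c d : ℝ) (h : ∀ n : ℕ, c * ∑ i ∈ s, x i ^ n = d * ∑ j ∈ t, y j ^ n) (g : ℝ → ℝ) :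
    c * ∑ i ∈ s, g (x i) = d * ∑ j ∈ t, g (y j) := by
  classical
  -- Only finitely many values occur, and on them g agrees with an interpolation polynomial, whose
  -- sums are combinations of moments.
  set S : Finset ℝ := s.image x ∪ t.image y with hS
  set p := Lagrange.interpolate S id g with hp
  have hg : ∀ z ∈ S, g z = p.eval z := fun z hz =>
    (Lagrange.eval_interpolate_at_node g (Set.injOn_id _) hz).symm
  rw [Finset.sum_congr rfl fun i hi => hg (x i)
      (Finset.mem_union_left _ (Finset.mem_image_of_mem x hi)),
    Finset.sum_congr rfl fun j hj => hg (y j)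
      (Finset.mem_union_right _ (Finset.mem_image_of_mem y hj))]
  simp only [Polynomial.eval_eq_sum_range]
  rw [Finset.sum_comm, Finset.sum_comm (s := t)]
  simp only [← Finset.mul_sum]
  rw [Finset.mul_sum, Finset.mul_sum]
  refine Finset.sum_congr rfl fun n _ => ?_
  linear_combination p.coeff n * h n

section Spectral

variable {ι : Type*} [Fintype ι] [DecidableEq ι]

theorem conj_diagonal_pow {V : Matrix ι ι ℂ} (hV : Vᴴ * V = 1) (hV' : V * Vᴴ = 1) (d : ι → ℂ)
    (n : ℕ) : (V * diagonal d * Vᴴ) ^ n = V * diagonal (fun k => d k ^ n) * Vᴴ := by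
  induction n with
  | zero => simp [hV']
  | succ n ih =>
    rw [pow_succ, ih, show V * diagonal (fun k => d k ^ n) * Vᴴ * (V * diagonal d * Vᴴ) =
      V * diagonal (fun k => d k ^ n) * (Vᴴ * V) * diagonal d * Vᴴ by noncomm_ring, hV, mul_one,
      mul_assoc V, diagonal_mul_diagonal]
    simp only [pow_succ]

theorem trace_conj_diagonal {V : Matrix ι ι ℂ} (hV : Vᴴ * V = 1) (d : ι → ℂ) :
    trace (V * diagonal d * Vᴴ) = ∑ k, d k := by
  rw [trace_mul_comm, ← mul_assoc, hV, one_mul, trace_diagonal]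

theorem trace_pow_eq {A : Matrix ι ι ℂ} (hA : A.IsHermitian) (n : ℕ) :
    trace (A ^ n) = ((∑ k, hA.eigenvalues k ^ n : ℝ) : ℂ) := by
  have hV := (Matrix.mem_unitaryGroup_iff').mp hA.eigenvectorUnitary.2
  have hV' := (Matrix.mem_unitaryGroup_iff).mp hA.eigenvectorUnitary.2
  have hs : A = hA.eigenvectorUnitary.1 * diagonal (fun k => (hA.eigenvalues k : ℂ)) *
      (hA.eigenvectorUnitary.1)ᴴ := by
    conv_lhs => rw [hA.spectral_theorem]
    rfl
  conv_lhs => rw [hs]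
  rw [conj_diagonal_pow hV hV', trace_conj_diagonal hV]
  push_cast
  rfl

theorem trace_sq_sub_pow_eq {A : Matrix ι ι ℂ} (hA : A.IsHermitian) (n : ℕ) :
    trace ((A ^ 2 - 4) ^ n) = ((∑ k, (hA.eigenvalues k ^ 2 - 4) ^ n : ℝ) : ℂ) := by
  have hV := (Matrix.mem_unitaryGroup_iff').mp hA.eigenvectorUnitary.2
  have hV' := (Matrix.mem_unitaryGroup_iff).mp hA.eigenvectorUnitary.2
  set V : Matrix ι ι ℂ := hA.eigenvectorUnitary.1
  change Vᴴ * V = 1 at hV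
  change V * Vᴴ = 1 at hV'
  have hs : A = V * diagonal (fun k => (hA.eigenvalues k : ℂ)) * Vᴴ := by
    conv_lhs => rw [hA.spectral_theorem]
    rfl
  have h4 : (4 : Matrix ι ι ℂ) = V * diagonal (fun _ => (4 : ℂ)) * Vᴴ := by
    have h5 : (diagonal fun _ => (4 : ℂ) : Matrix ι ι ℂ) = (4 : ℂ) • 1 := by
      rw [← diagonal_one, ← diagonal_smul]; congr 1; funext i; simp
    rw [h5, mul_smul_comm, mul_one, smul_mul_assoc, hV']
    ext i j; simp [ofNat_apply, one_apply]
  have hs2 : A ^ 2 - 4 = V * diagonal (fun k => (hA.eigenvalues k : ℂ) ^ 2 - 4) * Vᴴ := by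
    conv_lhs => rw [hs, conj_diagonal_pow hV hV', h4]
    rw [← sub_mul, ← mul_sub, diagonal_sub]
  rw [hs2, conj_diagonal_pow hV hV', trace_conj_diagonal hV]
  push_cast
  rfl

end Spectral

/-- The `n`-th angle `θ` with `e ^ {iMθ} = a`. -/
def twistAngle (M : ℕ) (a : ℤˣ) (n : ℕ) : ℝ :=
  2 * Real.pi * ((n : ℝ) + if a = 1 then 0 else 1 / 2) / M

/-- The `n`-th solution of `u ^ M = a`. -/
def twistRoot (M : ℕ) (a : ℤˣ) (n : ℕ) : ℂ := Complex.exp (twistAngle M a n * Complex.I)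

section Twist

variable {M : ℕ} (a : ℤˣ)

theorem twistRoot_eq (hM : 0 < M) (n : ℕ) :
    twistRoot M a n = Complex.exp (2 * Real.pi * Complex.I / M) ^ n * twistRoot M a 0 := by
  have : (M : ℂ) ≠ 0 := by exact_mod_cast hM.ne'
  rw [twistRoot, twistRoot, ← Complex.exp_nat_mul, ← Complex.exp_add, twistAngle, twistAngle]
  congr 1
  split_ifs <;> push_cast <;> field_simp <;> ring

theorem twistRoot_zero_pow (hM : 0 < M) : twistRoot M a 0 ^ M = ((a : ℤ) : ℂ) := by
  have hM' : (M : ℂ) ≠ 0 := by exact_mod_cast hM.ne'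
  rw [twistRoot, ← Complex.exp_nat_mul, twistAngle]
  rcases Int.units_eq_one_or a with rfl | rfl
  · simp
  · rw [if_neg (by decide)]
    have : (M : ℂ) * (((2 * Real.pi * (((0 : ℕ) : ℝ) + 1 / 2) / M : ℝ) : ℂ) * Complex.I) =
        Real.pi * Complex.I := by
      push_cast
      field_simp
      ring
    rw [this, Complex.exp_pi_mul_I]
    simp

theorem twistRoot_pow (hM : 0 < M) (n : ℕ) : twistRoot M a n ^ M = ((a : ℤ) : ℂ) := by
  rw [twistRoot_eq a hM, mul_pow, twistRoot_zero_pow a hM, ← pow_mul, mul_comm n, pow_mul,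
    (Complex.isPrimitiveRoot_exp M hM.ne').pow_eq_one, one_pow, one_mul]

theorem sum_twistRoot_pow (hM : 0 < M) {i : ℕ} (hi : ¬ M ∣ i) :
    ∑ n ∈ Finset.range M, twistRoot M a n ^ i = 0 := by
  have hζ := Complex.isPrimitiveRoot_exp M hM.ne'
  set ζ := Complex.exp (2 * Real.pi * Complex.I / M)
  have h1 : ∀ n ∈ Finset.range M, twistRoot M a n ^ i = (ζ ^ i) ^ n * twistRoot M a 0 ^ i := by
    intro n _
    rw [twistRoot_eq a hM, mul_pow, ← pow_mul, ← pow_mul, mul_comm n]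
  rw [Finset.sum_congr rfl h1, ← Finset.sum_mul]
  have h2 : ζ ^ i ≠ 1 := fun h => hi (hζ.dvd_of_pow_eq_one i h)
  have h3 := mul_geom_sum (ζ ^ i) M
  rw [← pow_mul, mul_comm i, pow_mul, hζ.pow_eq_one, one_pow, sub_self] at h3
  rw [(mul_eq_zero.mp h3).resolve_left (sub_ne_zero.mpr h2), zero_mul]

/-- The twisted roots are all the roots of X ^ M - a. At z = -1 this later bounds the smallest
eigenvalues of the π-flux phase. -/
theorem prod_sub_twistRoot (hM : 0 < M) (z : ℂ) :
    ∏ n ∈ Finset.range M, (z - twistRoot M a n) = z ^ M - ((a : ℤ) : ℂ) := by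
  have hζ := Complex.isPrimitiveRoot_exp M hM.ne'
  have h := congrArg (Polynomial.eval z)
    (X_pow_sub_C_eq_prod hζ hM (twistRoot_zero_pow a hM))
  rw [Polynomial.eval_prod] at h
  simp only [Polynomial.eval_sub, Polynomial.eval_pow, Polynomial.eval_X, Polynomial.eval_C] at h
  rw [h]
  exact Finset.prod_congr rfl fun n _ => by rw [twistRoot_eq a hM]

theorem two_cos_twistAngle (hM : 0 < M) (n : ℕ) :
    ((2 * Real.cos (twistAngle M a n) : ℝ) : ℂ) =
      twistRoot M a n + ((a : ℤ) : ℂ) * twistRoot M a n ^ (M - 1) := by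
  have h1 : twistRoot M a n ≠ 0 := Complex.exp_ne_zero _
  have h2 : ((a : ℤ) : ℂ) * twistRoot M a n ^ (M - 1) = (twistRoot M a n)⁻¹ := by
    refine eq_inv_of_mul_eq_one_left ?_
    rw [mul_assoc, ← pow_succ, Nat.sub_add_cancel hM,
      twistRoot_pow a hM, intUnit_mul_self]
  rw [h2, twistRoot, ← Complex.exp_neg]
  push_cast
  rw [Complex.two_cos, neg_mul]

end Twist

/-- The density of states of `c + U + U⁻¹ + V + V⁻¹` for commuting `U`, `V` whose powers are
traceless except for the trivial ones. -/
theorem trace_pow_twist {ι : Type*} [Fintype ι] [DecidableEq ι] {M : ℕ} (hM : 0 < M)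
    {U U' V V' : Matrix ι ι ℂ} (hUV : Commute U V) (hU : U * U' = 1) (hV : V * V' = 1)
    {a b : ℤˣ} (hUM : U ^ M = ((a : ℤ) : ℂ) • 1) (hVM : V ^ M = ((b : ℤ) : ℂ) • 1)
    (htr : ∀ i j, ¬ (M ∣ i ∧ M ∣ j) → trace (U ^ i * V ^ j) = 0) (c : ℝ) (n : ℕ) :
    (M : ℂ) ^ 2 * trace (((c : ℂ) • 1 + U + U' + V + V') ^ n) =
      Fintype.card ι * ((∑ p ∈ Finset.range M, ∑ q ∈ Finset.range M,
        (c + 2 * Real.cos (twistAngle M a p) + 2 * Real.cos (twistAngle M b q)) ^ n : ℝ) : ℂ) := by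
  -- Inverses become positive powers because the M-th power is ±1, so natural exponents suffice
  -- throughout.
  have inv_eq : ∀ {W W' : Matrix ι ι ℂ} {e : ℤˣ}, W * W' = 1 → W ^ M = ((e : ℤ) : ℂ) • 1 →
      W' = ((e : ℤ) : ℂ) • W ^ (M - 1) := by
    intro W W' e h1 h2
    have h3 : (((e : ℤ) : ℂ) • W ^ (M - 1)) * W = 1 := by
      rw [smul_mul_assoc, ← pow_succ, Nat.sub_add_cancel hM, h2, smul_smul, intUnit_mul_self,
        one_smul]
    calc W' = (((e : ℤ) : ℂ) • W ^ (M - 1)) * W * W' := by rw [h3, one_mul]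
      _ = _ := by rw [mul_assoc, h1, mul_one]
  have hU' := inv_eq hU hUM
  have hV' := inv_eq hV hVM
  set K := (c : ℂ) • 1 + U + U' + V + V' with hK
  set u := twistRoot M a
  set v := twistRoot M b
  -- The monomial prefactor makes the induction close: each factor of K only shifts the exponents i
  -- and j. The base case matches tracelessness of monomials with the vanishing of power sums over
  -- the twisted roots.
  have key : ∀ n i j : ℕ, (M : ℂ) ^ 2 * trace (U ^ i * V ^ j * K ^ n) = Fintype.card ι *
      ∑ p ∈ Finset.range M, ∑ q ∈ Finset.range M, u p ^ i * v q ^ j *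
        ((c : ℂ) + (u p + ((a : ℤ) : ℂ) * u p ^ (M - 1)) +
          (v q + ((b : ℤ) : ℂ) * v q ^ (M - 1))) ^ n := by
    intro n
    induction n with
    | zero =>
      intro i j
      simp only [pow_zero, mul_one]
      rw [← Finset.sum_mul_sum]
      by_cases h : M ∣ i ∧ M ∣ j
      · obtain ⟨⟨i', rfl⟩, ⟨j', rfl⟩⟩ := h
        have e1 : ∀ p, u p ^ (M * i') = ((a : ℤ) : ℂ) ^ i' := fun p => by
          rw [pow_mul, twistRoot_pow a hM]
        have e2 : ∀ p, v p ^ (M * j') = ((b : ℤ) : ℂ) ^ j' := fun p => by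
          rw [pow_mul, twistRoot_pow b hM]
        simp only [e1, e2, Finset.sum_const, Finset.card_range, nsmul_eq_mul]
        rw [pow_mul, pow_mul, hUM, hVM, smul_pow, smul_pow, one_pow, one_pow, smul_mul_smul_comm,
          mul_one, trace_smul, trace_one, smul_eq_mul]
        ring
      · rw [htr i j h]
        by_cases hi : M ∣ i
        · rw [sum_twistRoot_pow b hM (fun hj => h ⟨hi, hj⟩)]; simp
        · rw [sum_twistRoot_pow a hM hi]; simp
    | succ n ih =>
      intro i j
      have e1 : U ^ i * V ^ j * K ^ (n + 1) = (c : ℂ) • (U ^ i * V ^ j * K ^ n) +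
          U ^ (i + 1) * V ^ j * K ^ n + ((a : ℤ) : ℂ) • (U ^ (i + (M - 1)) * V ^ j * K ^ n) +
          U ^ i * V ^ (j + 1) * K ^ n + ((b : ℤ) : ℂ) • (U ^ i * V ^ (j + (M - 1)) * K ^ n) := by
        have hc : ∀ k l : ℕ, V ^ l * U ^ k = U ^ k * V ^ l :=
          fun k l => (hUV.pow_pow k l).eq.symm
        have d1 : U ^ i * V ^ j * U = U ^ (i + 1) * V ^ j := by
          have := hc 1 j
          rw [pow_one] at this
          rw [mul_assoc, this, ← mul_assoc, pow_succ]
        have d2 : U ^ i * V ^ j * U' = ((a : ℤ) : ℂ) • (U ^ (i + (M - 1)) * V ^ j) := by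
          rw [hU', mul_smul_comm, mul_assoc, hc, ← mul_assoc, pow_add]
        have d3 : U ^ i * V ^ j * V = U ^ i * V ^ (j + 1) := by rw [mul_assoc, ← pow_succ]
        have d4 : U ^ i * V ^ j * V' = ((b : ℤ) : ℂ) • (U ^ i * V ^ (j + (M - 1))) := by
          rw [hV', mul_smul_comm, mul_assoc, pow_add]
        rw [pow_succ', ← mul_assoc]
        conv_lhs => rw [hK]
        rw [mul_add, mul_add, mul_add, mul_add, d1, d2, d3, d4, mul_smul_comm, mul_one]
        simp only [add_mul, smul_mul_assoc, ← hK]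
      rw [e1]
      simp only [trace_add, trace_smul, smul_eq_mul, mul_add]
      have f1 := ih i j
      have f2 := ih (i + 1) j
      have f3 := ih (i + (M - 1)) j
      have f4 := ih i (j + 1)
      have f5 := ih i (j + (M - 1))
      have e2 : ∀ w x : ℂ, ∀ y : ℂ, w * (x * y) = x * (w * y) := fun w x y => by ring
      rw [e2 _ (c : ℂ), e2 _ ((a : ℤ) : ℂ), e2 _ ((b : ℤ) : ℂ), f1, f2, f3, f4, f5]
      simp only [Finset.mul_sum, ← Finset.sum_add_distrib]
      refine Finset.sum_congr rfl fun p _ => Finset.sum_congr rfl fun q _ => ?_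
      simp only [pow_succ, pow_add]
      ring
  have := key n 0 0
  simp only [pow_zero, one_mul] at this
  rw [this]
  congr 1
  push_cast
  refine Finset.sum_congr rfl fun p _ => Finset.sum_congr rfl fun q _ => ?_
  congr 1
  have h1 := two_cos_twistAngle a hM p
  have h2 := two_cos_twistAngle b hM q
  push_cast at h1 h2
  rw [h1, h2]

end

/-! ### Densities of states and the free energy at low temperature -/

section

open Matrix

set_option linter.unusedSectionVars false

variable {L : ℕ} [NeZero L]

theorem card_site : Fintype.card (Site L) = L ^ 2 := by
  rw [Fintype.card_prod, ZMod.card, pow_two]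

theorem smul_one_eq_ofNat {ι : Type*} [Fintype ι] [DecidableEq ι] (n : ℕ) [n.AtLeastTwo] :
    (((OfNat.ofNat n : ℝ) : ℂ) • 1 : Matrix ι ι ℂ) = OfNat.ofNat n := by
  ext i j
  by_cases h : i = j
  · simp [ofNat_apply, one_apply, h]
    exact (Nat.cast_ofNat (R := ℂ)).symm
  · simp [ofNat_apply, one_apply, h]

theorem hopMat_eq (σ : GaugeField L) : hopMat σ =
    magTrans σ 0 + (magTrans σ 0)ᴴ + magTrans σ 1 + (magTrans σ 1)ᴴ := rfl

/-- The eigenvalues of the hopping matrix. -/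
def hopEig (σ : GaugeField L) : Site L → ℝ := (isHermitian_hopMat σ).eigenvalues

theorem trace_pow_mul_pow_pow (σ : GaugeField L) {r M : ℕ} (hL : L = r * M) (hr : 0 < r)
    {i j : ℕ} (h : ¬ (M ∣ i ∧ M ∣ j)) :
    trace ((magTrans σ 0 ^ r) ^ i * (magTrans σ 1 ^ r) ^ j) = 0 := by
  rw [← pow_mul, ← pow_mul]
  refine trace_magTrans_pow_mul_pow σ fun h' => h ?_
  rw [hL] at h'
  exact ⟨Nat.dvd_of_mul_dvd_mul_left hr h'.1, Nat.dvd_of_mul_dvd_mul_left hr h'.2⟩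

theorem magTrans_pow_pow (σ : GaugeField L) {r M : ℕ} (hL : L = r * M)
    (h : ∀ μ ν, Commute (magTrans σ μ ^ r) (magTrans σ ν)) (μ : Fin 2) :
    (magTrans σ μ ^ r) ^ M = ((loopFlux σ μ : ℤ) : ℂ) • 1 := by
  have e : magTrans σ μ ^ L = (magTrans σ μ ^ r) ^ M :=
    (congrArg (magTrans σ μ ^ ·) hL).trans (pow_mul _ _ _)
  rw [← e]
  refine magTrans_pow σ μ fun ν => ?_
  rw [e]
  exact (h μ ν).pow_left M

theorem pow_mul_conjTranspose_pow (σ : GaugeField L) (μ : Fin 2) (r : ℕ) :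
    magTrans σ μ ^ r * (magTrans σ μ)ᴴ ^ r = 1 := by
  have h : Commute (magTrans σ μ) (magTrans σ μ)ᴴ := by
    show _ = _
    rw [magTrans_mul_conjTranspose, conjTranspose_mul_magTrans]
  rw [← h.mul_pow, magTrans_mul_conjTranspose, one_pow]

/-- The density of states in the `π`-flux phase. -/
theorem pi_density {M : ℕ} (hM : 0 < M) (hL : L = 2 * M) {σ : GaugeField L}
    (hσ : ∀ p, plaquetteFlux σ p = piFlux L p) (g : ℝ → ℝ) :
    (M : ℝ) ^ 2 * ∑ k, g (hopEig σ k ^ 2) =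
      (L : ℝ) ^ 2 * ∑ p ∈ Finset.range M, ∑ q ∈ Finset.range M,
        g (4 + 2 * Real.cos (twistAngle M (loopFlux σ 0) p) +
          2 * Real.cos (twistAngle M (loopFlux σ 1) q)) := by
  have hR := piFluxRelations hσ
  have hcomm : ∀ μ ν, Commute (magTrans σ μ ^ 2) (magTrans σ ν) := by
    intro μ ν
    have h0 : ∀ μ, Commute (magTrans σ μ ^ 2) (magTrans σ μ) :=
      fun μ => (Commute.refl _).pow_left 2
    fin_cases μ <;> fin_cases ν
    · exact h0 0
    · exact hR.commute_sq
    · exact hR.symm.commute_sq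
    · exact h0 1
  rw [← Finset.sum_product']
  refine sum_eq_of_moments Finset.univ (Finset.range M ×ˢ Finset.range M)
    (fun k => hopEig σ k ^ 2)
    (fun pq => 4 + 2 * Real.cos (twistAngle M (loopFlux σ 0) pq.1) +
      2 * Real.cos (twistAngle M (loopFlux σ 1) pq.2)) _ _ (fun n => ?_) g
  rw [Finset.sum_product]
  -- Here U and V are the squared translations, which commute with everything, and c = 4; the
  -- moments of λ² are the traces of the powers of A².
  have h1 := trace_pow_twist hM ((hcomm 0 1).pow_right 2) (pow_mul_conjTranspose_pow σ 0 2)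
    (pow_mul_conjTranspose_pow σ 1 2) (magTrans_pow_pow σ hL hcomm 0)
    (magTrans_pow_pow σ hL hcomm 1) (fun i j => trace_pow_mul_pow_pow σ hL two_pos) 4 n
  rw [smul_one_eq_ofNat, ← hR.sq_sum, card_site, ← pow_mul, ← hopMat_eq] at h1
  have h2 := trace_pow_eq (isHermitian_hopMat σ) (2 * n)
  rw [h2] at h1
  have h3 : ∀ k, (hopEig σ k ^ 2) ^ n = (isHermitian_hopMat σ).eigenvalues k ^ (2 * n) :=
    fun k => (pow_mul _ 2 n).symm
  simp only [h3]
  exact_mod_cast h1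

/-- The density of states in the chessboard configuration. -/
theorem chess_density {M : ℕ} (hM : 0 < M) (hL : L = 4 * M) {σ : GaugeField L}
    (hσ : ∀ p, plaquetteFlux σ p = chessFlux L p) (g : ℝ → ℝ) :
    (2 * (M : ℝ) ^ 2) * ∑ k, g (hopEig σ k ^ 2) =
      (L : ℝ) ^ 2 * ∑ p ∈ Finset.range M, ∑ q ∈ Finset.range M,
        (g (4 + √(8 + 2 * Real.cos (twistAngle M (loopFlux σ 0) p) +
          2 * Real.cos (twistAngle M (loopFlux σ 1) q))) +
        g (4 - √(8 + 2 * Real.cos (twistAngle M (loopFlux σ 0) p) +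
          2 * Real.cos (twistAngle M (loopFlux σ 1) q)))) := by
  have h4 : 4 ∣ L := ⟨M, hL⟩
  have hR := chessRelations h4 hσ
  have hcomm : ∀ μ ν, Commute (magTrans σ μ ^ 4) (magTrans σ ν) := by
    intro μ ν
    have h0 : ∀ μ, Commute (magTrans σ μ ^ 4) (magTrans σ μ) :=
      fun μ => (Commute.refl _).pow_left 4
    fin_cases μ <;> fin_cases ν
    · exact h0 0
    · exact hR.commute_pow_four
    · exact hR.symm.commute_pow_four
    · exact h0 1
  set κ : ℕ × ℕ → ℝ := fun pq => 8 + 2 * Real.cos (twistAngle M (loopFlux σ 0) pq.1) +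
    2 * Real.cos (twistAngle M (loopFlux σ 1) pq.2) with hκ
  have hκ0 : ∀ pq, 0 ≤ κ pq := fun pq => by
    have := Real.neg_one_le_cos (twistAngle M (loopFlux σ 0) pq.1)
    have := Real.neg_one_le_cos (twistAngle M (loopFlux σ 1) pq.2)
    simp only [hκ]
    linarith
  -- The Boolean chooses the branch of λ² - 4 = ±√κ.
  set y : Bool × (ℕ × ℕ) → ℝ := fun z => (if z.1 then 1 else -1) * √(κ z.2) with hy
  set T := (Finset.univ : Finset Bool) ×ˢ (Finset.range M ×ˢ Finset.range M) with hT
  have hsplit : ∀ f : ℝ → ℝ, ∑ z ∈ T, f (y z) =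
      ∑ p ∈ Finset.range M, ∑ q ∈ Finset.range M, (f (√(κ (p, q))) + f (-√(κ (p, q)))) := by
    intro f
    rw [hT, Finset.sum_product, Fintype.sum_bool, ← Finset.sum_add_distrib, Finset.sum_product]
    simp [hy]
  have key := sum_eq_of_moments Finset.univ T (fun k => hopEig σ k ^ 2 - 4) y
    (2 * (M : ℝ) ^ 2) ((L : ℝ) ^ 2) (fun n => ?_) (fun x => g (4 + x))
  · rw [hsplit (fun x => g (4 + x))] at key
    simp only [add_sub_cancel] at key
    exact key
  · have h2 := trace_sq_sub_pow_eq (isHermitian_hopMat σ) n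
    rw [hsplit (fun x => x ^ n)]
    -- Even moments come from (A² - 4)², a sum in the commuting fourth powers; odd moments vanish on
    -- both sides.
    rcases Nat.even_or_odd n with hn | hn
    · obtain ⟨m, rfl⟩ := hn.exists_two_nsmul
      rw [smul_eq_mul] at h2 ⊢
      have e : ∀ pq, √(κ pq) ^ (2 * m) = κ pq ^ m := fun pq => by
        rw [pow_mul, Real.sq_sqrt (hκ0 pq)]
      simp only [(even_two_mul m).neg_pow, e, ← two_mul, ← Finset.mul_sum]
      have h1 := trace_pow_twist hM ((hcomm 0 1).pow_right 4) (pow_mul_conjTranspose_pow σ 0 4)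
        (pow_mul_conjTranspose_pow σ 1 4) (magTrans_pow_pow σ hL hcomm 0)
        (magTrans_pow_pow σ hL hcomm 1) (fun i j => trace_pow_mul_pow_pow σ hL four_pos) 8 m
      rw [smul_one_eq_ofNat, ← hR.sq_sum_sq, card_site, ← pow_mul, ← hopMat_eq] at h1
      rw [h2] at h1
      have h3 : (M : ℝ) ^ 2 * ∑ k, (hopEig σ k ^ 2 - 4) ^ (2 * m) =
          (L : ℝ) ^ 2 * ∑ p ∈ Finset.range M, ∑ q ∈ Finset.range M, κ (p, q) ^ m := by
        have h1' := h1
        norm_cast at h1'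
        exact_mod_cast h1'
      rw [mul_assoc, h3]
      ring
    · rw [trace_hopMat_sq_odd h4 hσ hn] at h2
      have h3 : ∑ k, (hopEig σ k ^ 2 - 4) ^ n = 0 := by exact_mod_cast h2.symm
      rw [h3]
      simp [hn.neg_pow]

/-- The spectrum of the hopping matrix is symmetric, because the lattice is bipartite. -/
theorem sum_hopEig_neg (h4 : 4 ∣ L) (σ : GaugeField L) (g : ℝ → ℝ) :
    ∑ k, g (-hopEig σ k) = ∑ k, g (hopEig σ k) := by
  have := sum_eq_of_moments Finset.univ Finset.univ (fun k => -hopEig σ k) (hopEig σ) 1 1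
    (fun n => ?_) g
  · simpa using this
  · rw [one_mul, one_mul]
    rcases Nat.even_or_odd n with hn | hn
    · simp only [hn.neg_pow]
    · have h := trace_pow_eq (isHermitian_hopMat σ) n
      rw [trace_hopMat_odd h4 σ hn] at h
      have h' : ∑ k, hopEig σ k ^ n = 0 := by exact_mod_cast h.symm
      simp only [hn.neg_pow, Finset.sum_neg_distrib, h', neg_zero]

/-- If the hopping matrix is invertible, half of its eigenvalues are positive. -/
theorem card_pos_hopEig (h4 : 4 ∣ L) (σ : GaugeField L) (h0 : ∀ k, hopEig σ k ≠ 0) :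
    Even (Finset.univ.filter fun k => 0 < hopEig σ k).card := by
  have h1 := sum_hopEig_neg h4 σ fun x => if 0 < x then 1 else 0
  have h2 : ∑ k : Site L, ((if 0 < hopEig σ k then 1 else 0) +
      (if 0 < -hopEig σ k then (1 : ℝ) else 0)) = ∑ k : Site L, 1 := by
    refine Finset.sum_congr rfl fun k _ => ?_
    rcases lt_or_gt_of_ne (h0 k) with h | h
    · simp [h, h.not_gt]
    · simp [h, h.not_gt]
  rw [Finset.sum_add_distrib, h1] at h2
  simp only [Finset.sum_boole, Finset.sum_const, nsmul_eq_mul, mul_one, Finset.card_univ,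
    card_site] at h2
  obtain ⟨ℓ, rfl⟩ := h4
  have h3 : (Finset.univ.filter fun k => 0 < hopEig σ k).card +
      (Finset.univ.filter fun k => 0 < hopEig σ k).card = (4 * ℓ) ^ 2 := by exact_mod_cast h2
  -- The number of positive eigenvalues is (4ℓ)² / 2 = 8ℓ².
  refine ⟨4 * ℓ ^ 2, ?_⟩
  nlinarith

theorem one_add_sign_exp_ne_zero {s : ℤˣ} {x : ℝ} (h : s = -1 → x ≠ 0) :
    1 + ((s : ℤ) : ℝ) * Real.exp x ≠ 0 := by
  rcases Int.units_eq_one_or s with rfl | rfl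
  · have := Real.exp_pos x
    simp
    positivity
  · have h1 := h rfl
    intro h2
    apply h1
    have : Real.exp x = 1 := by
      push_cast at h2
      linarith
    exact Real.exp_eq_one_iff x |>.mp this

/-- The logarithm of the partition function is the ground state energy plus a correction. -/
theorem log_partitionOf (h4 : 4 ∣ L) (s : ℤˣ) {t β : ℝ} (ht : 0 < t) (hβ : 0 < β)
    (σ : GaugeField L) (h0 : s = -1 → ∀ k, hopEig σ k ≠ 0) :
    0 < partitionOf s t β σ ∧ Real.log (partitionOf s t β σ) =
      ∑ k, (β * t * |hopEig σ k| / 2 +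
        Real.log (1 + ((s : ℤ) : ℝ) * Real.exp (-(β * t * |hopEig σ k|)))) := by
  have hβt : 0 < β * t := mul_pos hβ ht
  have hZ : partitionOf s t β σ =
      ∏ k, (1 + ((s : ℤ) : ℝ) * Real.exp (β * t * hopEig σ k)) := partitionOf_eq s t β σ
  have hne : ∀ k, 1 + ((s : ℤ) : ℝ) * Real.exp (β * t * hopEig σ k) ≠ 0 := fun k =>
    one_add_sign_exp_ne_zero fun hs => mul_ne_zero hβt.ne' (h0 hs k)
  have hne' : ∀ k, 1 + ((s : ℤ) : ℝ) * Real.exp (-(β * t * hopEig σ k)) ≠ 0 := fun k =>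
    one_add_sign_exp_ne_zero fun hs => neg_ne_zero.mpr (mul_ne_zero hβt.ne' (h0 hs k))
  constructor
  · rw [hZ]
    rcases Int.units_eq_one_or s with rfl | rfl
    · refine Finset.prod_pos fun k _ => ?_
      have := Real.exp_pos (β * t * hopEig σ k)
      simp
      positivity
    -- For s = -1 the factor 1 - e^{βtλ} is negative exactly when λ > 0. The number of such factors
    -- is even, so the product is positive.
    · have hk0 := h0 rfl
      have e : ∀ k, 1 + (((-1 : ℤˣ) : ℤ) : ℝ) * Real.exp (β * t * hopEig σ k) =
          (if 0 < hopEig σ k then -1 else 1) *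
            |1 + (((-1 : ℤˣ) : ℤ) : ℝ) * Real.exp (β * t * hopEig σ k)| := by
        intro k
        push_cast
        rcases lt_or_gt_of_ne (hk0 k) with h | h
        · have : Real.exp (β * t * hopEig σ k) < 1 := by
            rw [Real.exp_lt_one_iff]; exact mul_neg_of_pos_of_neg hβt h
          rw [if_neg h.not_gt, abs_of_pos (by linarith)]; ring
        · have : 1 < Real.exp (β * t * hopEig σ k) := by
            rw [Real.one_lt_exp_iff]; exact mul_pos hβt h
          rw [if_pos h, abs_of_neg (by linarith)]; ring
      rw [Finset.prod_congr rfl fun k _ => e k, Finset.prod_mul_distrib, Finset.prod_ite]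
      simp only [Finset.prod_const, one_pow, mul_one]
      rw [(card_pos_hopEig h4 σ hk0).neg_one_pow, one_mul]
      exact Finset.prod_pos fun k _ => abs_pos.mpr (hne k)
  · rw [hZ, Real.log_prod fun k _ => hne k]
    -- By symmetry of the spectrum, twice the sum pairs λ with -λ, and each pair contributes βt|λ|
    -- plus twice the correction.
    have hsym := sum_hopEig_neg h4 σ fun x =>
      Real.log (1 + ((s : ℤ) : ℝ) * Real.exp (β * t * x))
    have e : ∀ k, Real.log (1 + ((s : ℤ) : ℝ) * Real.exp (β * t * hopEig σ k)) +
        Real.log (1 + ((s : ℤ) : ℝ) * Real.exp (β * t * -hopEig σ k)) =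
        2 * (β * t * |hopEig σ k| / 2 +
          Real.log (1 + ((s : ℤ) : ℝ) * Real.exp (-(β * t * |hopEig σ k|)))) := by
      intro k
      have hs : ((s : ℤ) : ℝ) * ((s : ℤ) : ℝ) = 1 := by
        rcases Int.units_eq_one_or s with rfl | rfl <;> simp
      -- `Real.log (-1)` is 0, so the sign s drops out when it is factored out of the logarithm.
      have hs1 : Real.log ((s : ℤ) : ℝ) = 0 := by
        rcases Int.units_eq_one_or s with rfl | rfl <;> simp
      have hs0 : ((s : ℤ) : ℝ) ≠ 0 := left_ne_zero_of_mul_eq_one hs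
      have f : ∀ x : ℝ, 1 + ((s : ℤ) : ℝ) * Real.exp (-x) ≠ 0 →
          Real.log (1 + ((s : ℤ) : ℝ) * Real.exp x) =
            x + Real.log (1 + ((s : ℤ) : ℝ) * Real.exp (-x)) := by
        intro x hx
        have : 1 + ((s : ℤ) : ℝ) * Real.exp x =
            ((s : ℤ) : ℝ) * Real.exp x * (1 + ((s : ℤ) : ℝ) * Real.exp (-x)) := by
          have h1 : Real.exp x * Real.exp (-x) = 1 := by rw [← Real.exp_add]; simp
          linear_combination (-1 : ℝ) * hs - ((s : ℤ) : ℝ) * ((s : ℤ) : ℝ) * h1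
        rw [this, Real.log_mul (mul_ne_zero hs0 (Real.exp_ne_zero x)) hx,
          Real.log_mul hs0 (Real.exp_ne_zero x), hs1, Real.log_exp, zero_add]
      rw [mul_neg]
      rcases le_total 0 (hopEig σ k) with h | h
      · rw [abs_of_nonneg h, f _ (hne' k)]; ring
      · rw [abs_of_nonpos h, mul_neg, neg_neg, f (-(β * t * hopEig σ k)) (by
          rw [neg_neg]; exact hne k), neg_neg]
        ring
    have h2 : 2 * ∑ k, Real.log (1 + ((s : ℤ) : ℝ) * Real.exp (β * t * hopEig σ k)) =
        2 * ∑ k, (β * t * |hopEig σ k| / 2 +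
          Real.log (1 + ((s : ℤ) : ℝ) * Real.exp (-(β * t * |hopEig σ k|)))) := by
      rw [Finset.mul_sum (s := Finset.univ) (f := fun k => β * t * |hopEig σ k| / 2 + _),
        ← Finset.sum_congr rfl fun k _ => e k, Finset.sum_add_distrib, hsym, two_mul]
    linarith

/-- The logarithm of the correction is bounded below. -/
theorem log_sub_log_le (s : ℤˣ) {y : ℝ} (hy : 0 < y) :
    Real.log y - Real.log (1 + y) ≤ Real.log (1 + ((s : ℤ) : ℝ) * Real.exp (-y)) := by
  -- This bound is tight enough for large y and linear for small y, so that summing its logarithm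
  -- over the spectrum brings in Σ log|λ|.
  have h1 : y / (1 + y) ≤ 1 - Real.exp (-y) := by
    have h2 := Real.add_one_le_exp y
    have h3 : Real.exp (-y) ≤ 1 / (1 + y) := by
      rw [Real.exp_neg, ← one_div]
      exact one_div_le_one_div_of_le (by linarith) (by linarith)
    have h4 : y / (1 + y) = 1 - 1 / (1 + y) := by field_simp; ring
    linarith
  rw [← Real.log_div hy.ne' (by linarith)]
  refine Real.log_le_log (by positivity) (h1.trans ?_)
  have := Real.exp_pos (-y)
  rcases Int.units_eq_one_or s with rfl | rfl
  · push_cast; linarith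
  · push_cast; linarith

theorem log_le_log_two (s : ℤˣ) {y : ℝ} (hy : 0 ≤ y) :
    Real.log (1 + ((s : ℤ) : ℝ) * Real.exp (-y)) ≤ 1 := by
  have h1 := Real.exp_pos (-y)
  have h2 : Real.exp (-y) ≤ 1 := Real.exp_le_one_iff.mpr (by linarith)
  have h3 : (0 : ℝ) ≤ 1 + ((s : ℤ) : ℝ) * Real.exp (-y) ∧
      1 + ((s : ℤ) : ℝ) * Real.exp (-y) ≤ 2 := by
    rcases Int.units_eq_one_or s with rfl | rfl
    · push_cast; constructor <;> linarith
    · push_cast; constructor <;> linarith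
  -- The argument vanishes for s = -1, y = 0, where `Real.log 0 = 0` still satisfies the bound.
  rcases h3.1.eq_or_lt with h | h
  · rw [← h]; simp
  · have := Real.log_le_sub_one_of_pos h
    linarith

/-- The free energy differs from the ground state energy density by `O(1/β)`. -/
theorem free_energy_estimate (h4 : 4 ∣ L) (s : ℤˣ) {t β : ℝ} (ht : 0 < t) (hβ : 0 < β)
    (σ : GaugeField L) (h0 : ∀ k, hopEig σ k ≠ 0)
    (hlow : -(2 * (L : ℝ) ^ 2) ≤ ∑ k, (Real.log (β * t * |hopEig σ k|) -
      Real.log (1 + β * t * |hopEig σ k|))) :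
    0 < partitionOf s t β σ ∧
      |Real.log (partitionOf s t β σ) / (β * (L : ℝ) ^ 2) -
        t / 2 * ((∑ k, |hopEig σ k|) / (L : ℝ) ^ 2)| ≤ 2 / β := by
  obtain ⟨hpos, hlog⟩ := log_partitionOf h4 s ht hβ σ fun _ => h0
  refine ⟨hpos, ?_⟩
  have hL : (0 : ℝ) < L := by exact_mod_cast Nat.pos_of_ne_zero (NeZero.ne L)
  set R := ∑ k, Real.log (1 + ((s : ℤ) : ℝ) * Real.exp (-(β * t * |hopEig σ k|))) with hR
  have hR1 : R ≤ 2 * (L : ℝ) ^ 2 := by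
    calc R ≤ ∑ k : Site L, (1 : ℝ) := Finset.sum_le_sum fun k _ =>
          log_le_log_two s (by positivity)
      _ = (L : ℝ) ^ 2 := by
        rw [Finset.sum_const, Finset.card_univ, card_site]; simp
      _ ≤ _ := by nlinarith [sq_nonneg (L : ℝ)]
  -- Small eigenvalues matter only here; `hlow` is supplied by the gap for the chessboard and by the
  -- product of the eigenvalues for the π-flux phase.
  have hR2 : -(2 * (L : ℝ) ^ 2) ≤ R := hlow.trans <| Finset.sum_le_sum fun k _ =>
    log_sub_log_le s (mul_pos (mul_pos hβ ht) (abs_pos.mpr (h0 k)))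
  have hmain : Real.log (partitionOf s t β σ) / (β * (L : ℝ) ^ 2) -
      t / 2 * ((∑ k, |hopEig σ k|) / (L : ℝ) ^ 2) = R / (β * (L : ℝ) ^ 2) := by
    rw [hlog, Finset.sum_add_distrib, ← Finset.sum_div, ← Finset.mul_sum, ← hR]
    field_simp
    ring
  rw [hmain, abs_div, abs_of_pos (show (0 : ℝ) < β * (L : ℝ) ^ 2 by positivity),
    div_le_div_iff₀ (by positivity) hβ]
  have := abs_le.mpr ⟨hR2, hR1⟩
  nlinarith

end

/-! ### Riemann sums over twisted angles and the doubling of angles -/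

section

open Real intervalIntegral

/-- For both twists the n-th angle lies in the n-th cell of the uniform partition, so it is a
legitimate tag for a Riemann sum. -/
theorem twistAngle_mem {M : ℕ} (hM : 0 < M) (a : ℤˣ) (n : ℕ) :
    2 * π * n / M ≤ twistAngle M a n ∧ twistAngle M a n ≤ 2 * π * (n + 1) / M := by
  have hM' : (0 : ℝ) < M := by exact_mod_cast hM
  have hπ := Real.pi_pos
  unfold twistAngle
  constructor
  · apply div_le_div_of_nonneg_right _ hM'.le
    apply mul_le_mul_of_nonneg_left _ (by positivity)
    split_ifs <;> linarith
  · apply div_le_div_of_nonneg_right _ hM'.le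
    apply mul_le_mul_of_nonneg_left _ (by positivity)
    split_ifs <;> linarith

theorem twistAngle_mem_Icc {M : ℕ} (a : ℤˣ) {n : ℕ} (hn : n ∈ Finset.range M) :
    twistAngle M a n ∈ Set.Icc 0 (2 * π) := by
  have hn := Finset.mem_range.mp hn
  have hM : 0 < M := by omega
  have hM' : (0 : ℝ) < M := by exact_mod_cast hM
  have hπ := Real.pi_pos
  obtain ⟨h1, h2⟩ := twistAngle_mem hM a n
  have h3 : (n : ℝ) + 1 ≤ M := by exact_mod_cast hn
  refine ⟨le_trans (by positivity) h1, h2.trans ?_⟩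
  rw [div_le_iff₀ hM']
  exact mul_le_mul_of_nonneg_left h3 (by positivity)

/-- Riemann sums over twisted angles in one variable. -/
theorem riemann_sum_one {g : ℝ → ℝ} (hg : Continuous g) {M : ℕ} (hM : 0 < M) (a : ℤˣ) {ω : ℝ}
    (hω : ∀ x ∈ Set.Icc 0 (2 * π), ∀ y ∈ Set.Icc 0 (2 * π), |x - y| ≤ 2 * π / M →
      |g x - g y| ≤ ω) :
    |2 * π / M * ∑ p ∈ Finset.range M, g (twistAngle M a p) - ∫ x in (0 : ℝ)..(2 * π), g x| ≤
      2 * π * ω := by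
  have hM' : (0 : ℝ) < M := by exact_mod_cast hM
  have hπ := Real.pi_pos
  set e : ℕ → ℝ := fun p => 2 * π * p / M with he
  have he0 : e 0 = 0 := by simp [he]
  have heM : e M = 2 * π := by simp only [he]; field_simp
  have hed : ∀ p, e (p + 1) - e p = 2 * π / M := fun p => by
    simp only [he]; push_cast; field_simp; ring
  have hint : ∫ x in (0 : ℝ)..(2 * π), g x =
      ∑ p ∈ Finset.range M, ∫ x in e p..e (p + 1), g x := by
    rw [sum_integral_adjacent_intervals fun k _ => hg.intervalIntegrable _ _, he0, heM]
  rw [hint, Finset.mul_sum, ← Finset.sum_sub_distrib]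
  refine (Finset.abs_sum_le_sum_abs _ _).trans ?_
  have hterm : ∀ p ∈ Finset.range M,
      |2 * π / M * g (twistAngle M a p) - ∫ x in e p..e (p + 1), g x| ≤ ω * (2 * π / M) := by
    intro p hp
    have hlt : e p ≤ e (p + 1) := by
      have := hed p
      have : 0 ≤ 2 * π / (M : ℝ) := by positivity
      linarith
    have h1 : 2 * π / M * g (twistAngle M a p) = ∫ _ in e p..e (p + 1), g (twistAngle M a p) := by
      rw [integral_const, hed, smul_eq_mul]
    rw [h1, ← integral_sub intervalIntegrable_const (hg.intervalIntegrable _ _)]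
    have h2 := norm_integral_le_of_norm_le_const (a := e p) (b := e (p + 1))
      (f := fun x => g (twistAngle M a p) - g x) (C := ω) fun x hx => ?_
    · rw [Real.norm_eq_abs, hed, abs_of_nonneg (show (0 : ℝ) ≤ 2 * π / M by positivity)] at h2
      exact h2
    · rw [Set.uIoc_of_le hlt] at hx
      obtain ⟨m1, m2⟩ := twistAngle_mem hM a p
      have m1' : e p ≤ twistAngle M a p := m1
      have m2' : twistAngle M a p ≤ e (p + 1) := by simpa [he] using m2
      have hp' : (p : ℝ) + 1 ≤ M := by exact_mod_cast Finset.mem_range.mp hp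
      have hep : 0 ≤ e p := by simp only [he]; positivity
      have heq : e (p + 1) ≤ 2 * π := by
        simp only [he]
        push_cast
        rw [div_le_iff₀ hM']
        exact mul_le_mul_of_nonneg_left hp' (by positivity)
      have hd := hed p
      refine hω _ (twistAngle_mem_Icc a hp) _ ⟨by linarith [hx.1], by linarith [hx.2]⟩ ?_
      rw [abs_le]
      constructor <;> linarith [hx.1, hx.2]
  refine (Finset.sum_le_sum hterm).trans ?_
  rw [Finset.sum_const, Finset.card_range, nsmul_eq_mul]
  apply le_of_eq
  field_simp

/-- Riemann sums over twisted angles in two variables, uniformly in the twists. -/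
theorem riemann_sum_two {f : ℝ → ℝ → ℝ} (hf : Continuous (Function.uncurry f)) {ε : ℝ}
    (hε : 0 < ε) : ∃ M₀ : ℕ, ∀ M : ℕ, M₀ ≤ M → ∀ a b : ℤˣ,
      |(∑ p ∈ Finset.range M, ∑ q ∈ Finset.range M, f (twistAngle M a p) (twistAngle M b q)) /
          (M : ℝ) ^ 2 -
        1 / (4 * π ^ 2) * ∫ x in (0 : ℝ)..(2 * π), ∫ y in (0 : ℝ)..(2 * π), f x y| ≤ ε := by
  have hπ := Real.pi_pos
  have huc : UniformContinuousOn (Function.uncurry f)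
      (Set.Icc 0 (2 * π) ×ˢ Set.Icc 0 (2 * π)) :=
    (isCompact_Icc.prod isCompact_Icc).uniformContinuousOn_of_continuous hf.continuousOn
  rw [Metric.uniformContinuousOn_iff] at huc
  -- The inner and outer sums each cost (2π)² ε / 2, which the prefactor 1 / (4π²) turns into a
  -- total of ε. No choice depends on the twists.
  obtain ⟨δ, hδ, hδf⟩ := huc (ε / 2) (by positivity)
  obtain ⟨M₁, hM₁⟩ := exists_nat_gt (2 * π / δ)
  refine ⟨M₁ + 1, fun M hMM a b => ?_⟩
  have hM : 0 < M := by omega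
  have hM' : (0 : ℝ) < M := by exact_mod_cast hM
  have hstep : 2 * π / M < δ := by
    rw [div_lt_iff₀ hM']
    rw [div_lt_iff₀ hδ] at hM₁
    have : (M₁ : ℝ) ≤ M := by exact_mod_cast (by omega : M₁ ≤ M)
    nlinarith
  have hmod : ∀ x ∈ Set.Icc 0 (2 * π), ∀ x' ∈ Set.Icc 0 (2 * π), ∀ y ∈ Set.Icc 0 (2 * π),
      ∀ y' ∈ Set.Icc 0 (2 * π), |x - x'| ≤ 2 * π / M → |y - y'| ≤ 2 * π / M →
      |f x y - f x' y'| ≤ ε / 2 := by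
    intro x hx x' hx' y hy y' hy' h1 h2
    have := hδf (x, y) ⟨hx, hy⟩ (x', y') ⟨hx', hy'⟩ (by
      rw [Prod.dist_eq, Real.dist_eq, Real.dist_eq]
      exact max_lt (h1.trans_lt hstep) (h2.trans_lt hstep))
    rw [Real.dist_eq] at this
    exact this.le
  have h0 : |(0 : ℝ)| ≤ 2 * π / M := by rw [abs_zero]; positivity
  set G : ℝ → ℝ := fun x => ∫ y in (0 : ℝ)..(2 * π), f x y with hG
  have hfx : ∀ x, Continuous (f x) := fun x =>
    hf.comp (continuous_const.prodMk continuous_id)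
  have hGc : Continuous G := continuous_parametric_intervalIntegral_of_continuous' hf 0 (2 * π)
  have hinner : ∀ p ∈ Finset.range M, |2 * π / M * ∑ q ∈ Finset.range M,
      f (twistAngle M a p) (twistAngle M b q) - G (twistAngle M a p)| ≤ 2 * π * (ε / 2) :=
    fun p hp => riemann_sum_one (hfx _) hM b fun y hy y' hy' h =>
      hmod _ (twistAngle_mem_Icc a hp) _ (twistAngle_mem_Icc a hp) y hy y' hy'
        (by rw [sub_self]; exact h0) h
  have houter : |2 * π / M * ∑ p ∈ Finset.range M, G (twistAngle M a p) -
      ∫ x in (0 : ℝ)..(2 * π), G x| ≤ 2 * π * (2 * π * (ε / 2)) := by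
    refine riemann_sum_one hGc hM a fun x hx x' hx' h => ?_
    rw [hG]
    simp only
    rw [← integral_sub ((hfx x).intervalIntegrable _ _) ((hfx x').intervalIntegrable _ _)]
    have h2 := norm_integral_le_of_norm_le_const (a := 0) (b := 2 * π)
      (f := fun y => f x y - f x' y) (C := ε / 2) fun y hy => ?_
    · rw [Real.norm_eq_abs, sub_zero, abs_of_pos (show (0 : ℝ) < 2 * π by positivity)] at h2
      linarith
    · rw [Set.uIoc_of_le (by positivity)] at hy
      have hy' : y ∈ Set.Icc 0 (2 * π) := ⟨hy.1.le, hy.2⟩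
      exact hmod x hx x' hx' y hy' y hy' h (by rw [sub_self]; exact h0)
  set S := ∑ p ∈ Finset.range M, ∑ q ∈ Finset.range M, f (twistAngle M a p) (twistAngle M b q)
  have hsum : |2 * π / M * (2 * π / M * S) -
      2 * π / M * ∑ p ∈ Finset.range M, G (twistAngle M a p)| ≤ 2 * π * (2 * π * (ε / 2)) := by
    rw [← mul_sub, abs_mul, abs_of_pos (show (0 : ℝ) < 2 * π / M by positivity), Finset.mul_sum,
      ← Finset.sum_sub_distrib]
    have := (Finset.abs_sum_le_sum_abs _ _).trans (Finset.sum_le_sum hinner)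
    rw [Finset.sum_const, Finset.card_range, nsmul_eq_mul] at this
    refine (mul_le_mul_of_nonneg_left this (by positivity)).trans (le_of_eq ?_)
    field_simp
  have htot : |2 * π / M * (2 * π / M * S) - ∫ x in (0 : ℝ)..(2 * π), G x| ≤
      4 * π ^ 2 * ε := by
    refine (abs_sub_le _ _ _).trans ((add_le_add hsum houter).trans (le_of_eq ?_))
    ring
  have hfin : S / (M : ℝ) ^ 2 - 1 / (4 * π ^ 2) * ∫ x in (0 : ℝ)..(2 * π), G x =
      1 / (4 * π ^ 2) * (2 * π / M * (2 * π / M * S) - ∫ x in (0 : ℝ)..(2 * π), G x) := by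
    field_simp
    ring
  rw [hfin, abs_mul, abs_of_pos (show (0 : ℝ) < 1 / (4 * π ^ 2) by positivity)]
  refine (mul_le_mul_of_nonneg_left htot (by positivity)).trans (le_of_eq ?_)
  field_simp

/-- The doubled variable runs over two periods, which compensates the Jacobian 1/2. -/
theorem integral_comp_two_mul {g : ℝ → ℝ} (hg : Continuous g)
    (hp : Function.Periodic g (2 * π)) :
    ∫ x in (0 : ℝ)..(2 * π), g (2 * x) = ∫ x in (0 : ℝ)..(2 * π), g x := by
  rw [integral_comp_mul_left g two_ne_zero, mul_zero,
    ← integral_add_adjacent_intervals (hg.intervalIntegrable 0 (2 * π))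
      (hg.intervalIntegrable (2 * π) (2 * (2 * π)))]
  have := hp.intervalIntegral_add_eq (2 * π) 0
  rw [show 2 * π + 2 * π = 2 * (2 * π) by ring, zero_add] at this
  rw [this, smul_eq_mul]
  ring

/-- Doubling the angles does not change the integral over the torus. -/
theorem integral_cos_sq {F : ℝ → ℝ → ℝ} (hF : Continuous (Function.uncurry F)) :
    ∫ x in (0 : ℝ)..(2 * π), ∫ y in (0 : ℝ)..(2 * π), F (cos x ^ 2) (cos y ^ 2) =
      ∫ x in (0 : ℝ)..(2 * π), ∫ y in (0 : ℝ)..(2 * π),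
        F ((1 + cos x) / 2) ((1 + cos y) / 2) := by
  have h : ∀ x, cos x ^ 2 = (1 + cos (2 * x)) / 2 := fun x => by rw [cos_sq]; ring
  set K : ℝ → ℝ → ℝ := fun x y => F ((1 + cos x) / 2) ((1 + cos y) / 2) with hK
  have hc : Continuous (Function.uncurry K) :=
    hF.comp (g := Function.uncurry F)
      (f := fun z : ℝ × ℝ => ((1 + cos z.1) / 2, (1 + cos z.2) / 2)) (by fun_prop)
  have hKp : ∀ x y, K (x + 2 * π) y = K x y := fun x y => by simp only [hK, cos_add_two_pi]
  have hKp' : ∀ x y, K x (y + 2 * π) = K x y := fun x y => by simp only [hK, cos_add_two_pi]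
  have h0 : ∀ x y, F (cos x ^ 2) (cos y ^ 2) = K (2 * x) (2 * y) := fun x y => by
    simp only [hK, h]
  have hKx : ∀ x, Continuous (K x) := fun x =>
    hc.comp (continuous_const.prodMk continuous_id)
  simp only [h0]
  change _ = ∫ x in (0 : ℝ)..(2 * π), ∫ y in (0 : ℝ)..(2 * π), K x y
  clear_value K
  have h1 : ∀ x, ∫ y in (0 : ℝ)..(2 * π), K (2 * x) (2 * y) =
      ∫ y in (0 : ℝ)..(2 * π), K (2 * x) y := fun x =>
    integral_comp_two_mul (hKx _) (hKp' _)
  simp only [h1]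
  have hG : Continuous fun x => ∫ y in (0 : ℝ)..(2 * π), K x y :=
    continuous_parametric_intervalIntegral_of_continuous' hc 0 (2 * π)
  refine integral_comp_two_mul hG fun x => ?_
  simp only [hKp]

end

/-! ### Finite-volume free energies of the two configurations -/

section

set_option linter.unusedSectionVars false

variable {L : ℕ} [NeZero L]

theorem sum_abs_hopEig (σ : GaugeField L) :
    ∑ k, |hopEig σ k| = ∑ k, √(hopEig σ k ^ 2) := by
  simp only [Real.sqrt_sq_eq_abs]

/-- Each factor is |-1 - u|² with u a root of X ^ M + 1, so the product is the squared modulus of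
(-1) ^ M + 1 = 2. For odd M it would vanish. -/
theorem prod_two_add_cos {M : ℕ} (hM : 0 < M) (hM2 : Even M) :
    ∏ p ∈ Finset.range M, (2 + 2 * Real.cos (twistAngle M (-1) p)) = 4 := by
  have h1 : ∀ p ∈ Finset.range M, 2 + 2 * Real.cos (twistAngle M (-1) p) =
      Complex.normSq (-1 - twistRoot M (-1) p) := by
    intro p _
    have h2 := Real.sin_sq_add_cos_sq (twistAngle M (-1) p)
    rw [twistRoot, Complex.normSq_apply, Complex.sub_re, Complex.sub_im,
      Complex.exp_ofReal_mul_I_re, Complex.exp_ofReal_mul_I_im]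
    simp
    linear_combination -h2
  rw [Finset.prod_congr rfl h1, ← map_prod, prod_sub_twistRoot (-1) hM, hM2.neg_one_pow]
  norm_num [Complex.normSq_apply]

theorem two_add_cos_pos {M : ℕ} (hM : 0 < M) (hM2 : Even M) {p : ℕ} (hp : p ∈ Finset.range M) :
    0 < 2 + 2 * Real.cos (twistAngle M (-1) p) := by
  have h1 := Real.neg_one_le_cos (twistAngle M (-1) p)
  refine lt_of_le_of_ne (by linarith) fun h => ?_
  have := prod_two_add_cos hM hM2
  rw [Finset.prod_eq_zero hp h.symm] at this
  norm_num at this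

theorem sum_log_two_add_cos_nonneg {M : ℕ} (hM : 0 < M) (hM2 : Even M) :
    0 ≤ ∑ p ∈ Finset.range M, Real.log (2 + 2 * Real.cos (twistAngle M (-1) p)) := by
  rw [← Real.log_prod fun p hp => (two_add_cos_pos hM hM2 hp).ne', prod_two_add_cos hM hM2]
  exact Real.log_nonneg (by norm_num)

/-- A property that holds for no member of a family, expressed through a sum of indicators. -/
theorem sum_indicator_eq_zero {P : ℝ → Prop} [DecidablePred P] {x : Site L → ℝ}
    (h : ∑ k, (if P (x k) then (1 : ℝ) else 0) = 0) (k : Site L) : ¬ P (x k) := by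
  have := (Finset.sum_eq_zero_iff_of_nonneg fun k _ => by split_ifs <;> norm_num).mp h k
    (Finset.mem_univ k)
  intro hk
  rw [if_pos hk] at this
  exact one_ne_zero this

/-- The free energy of the `π`-flux phase in finite volume. -/
theorem pi_free_energy {ℓ : ℕ} (hℓ : 0 < ℓ) (hL : L = 4 * ℓ) (s : ℤˣ) {t β : ℝ} (ht : 0 < t)
    (hβ : 2 / t ≤ β) {σ : GaugeField L} (hσ : HasFluxes σ (piFlux L) (-1) (-1)) :
    0 < partitionOf s t β σ ∧
      |Real.log (partitionOf s t β σ) / (β * (L : ℝ) ^ 2) -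
        t / 2 * ((∑ p ∈ Finset.range (2 * ℓ), ∑ q ∈ Finset.range (2 * ℓ),
          √(4 + 2 * Real.cos (twistAngle (2 * ℓ) (-1) p) +
            2 * Real.cos (twistAngle (2 * ℓ) (-1) q))) / ((2 * ℓ : ℕ) : ℝ) ^ 2)| ≤ 2 / β := by
  have hβ0 : 0 < β := lt_of_lt_of_le (by positivity) hβ
  have hβt : 2 ≤ β * t := by rwa [div_le_iff₀ ht] at hβ
  set M := 2 * ℓ with hMdef
  have hM : 0 < M := by omega
  have hM2 : Even M := even_two_mul ℓ
  have hM' : (0 : ℝ) < M := by exact_mod_cast hM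
  have hL0 : (0 : ℝ) < L := by exact_mod_cast Nat.pos_of_ne_zero (NeZero.ne L)
  have h4 : 4 ∣ L := ⟨ℓ, hL⟩
  obtain ⟨hσ1, hσ2, hσ3⟩ := hσ
  have hden := pi_density hM (by omega : L = 2 * M) hσ1
  have hl0 : loopFlux σ 0 = -1 := hσ2
  have hl1 : loopFlux σ 1 = -1 := hσ3
  simp only [hl0, hl1] at hden
  have hκ : ∀ p ∈ Finset.range M, ∀ q, 2 + 2 * Real.cos (twistAngle M (-1) p) ≤
      4 + 2 * Real.cos (twistAngle M (-1) p) + 2 * Real.cos (twistAngle M (-1) q) := by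
    intro p _ q
    have := Real.neg_one_le_cos (twistAngle M (-1) q)
    linarith
  -- The density formula applied to an indicator: if no value of the explicit family lies in a set,
  -- no eigenvalue does. The same device gives the upper bound below.
  have hsq0 : ∀ k, 0 < hopEig σ k ^ 2 := by
    intro k
    have h := hden fun x => if x ≤ 0 then 1 else 0
    rw [Finset.sum_eq_zero (s := Finset.range M) fun p hp => Finset.sum_eq_zero fun q _ =>
      if_neg (not_le.mpr ((two_add_cos_pos hM hM2 hp).trans_le (hκ p hp q))), mul_zero] at h
    exact not_le.mp (sum_indicator_eq_zero (P := fun x => x ≤ 0)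
      ((mul_eq_zero.mp h).resolve_left (by positivity)) k)
  have hsq8 : ∀ k, hopEig σ k ^ 2 ≤ 9 := by
    intro k
    have h := hden fun x => if 9 < x then 1 else 0
    rw [Finset.sum_eq_zero (s := Finset.range M) fun p hp => Finset.sum_eq_zero fun q _ =>
      if_neg (by
        have := Real.cos_le_one (twistAngle M (-1) p)
        have := Real.cos_le_one (twistAngle M (-1) q)
        linarith), mul_zero] at h
    exact not_lt.mp (sum_indicator_eq_zero (P := fun x => 9 < x)
      ((mul_eq_zero.mp h).resolve_left (by positivity)) k)
  have h0 : ∀ k, hopEig σ k ≠ 0 := fun k h => by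
    have := hsq0 k
    rw [h] at this
    norm_num at this
  -- Discarding the nonnegative part 2 + 2cos of one direction leaves, for each q, the logarithm of
  -- the product 4. Thus the small eigenvalues near the Dirac points are harmless on average.
  have hlog : 0 ≤ ∑ k, Real.log |hopEig σ k| := by
    have h := hden Real.log
    have h1 : 0 ≤ ∑ p ∈ Finset.range M, ∑ q ∈ Finset.range M,
        Real.log (4 + 2 * Real.cos (twistAngle M (-1) p) +
          2 * Real.cos (twistAngle M (-1) q)) := by
      rw [Finset.sum_comm]
      refine Finset.sum_nonneg fun q _ => (sum_log_two_add_cos_nonneg hM hM2).trans ?_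
      exact Finset.sum_le_sum fun p hp => Real.log_le_log (two_add_cos_pos hM hM2 hp) (hκ p hp q)
    have h2 : 0 ≤ ∑ k, Real.log (hopEig σ k ^ 2) := by
      by_contra hneg
      have h3 : (M : ℝ) ^ 2 * ∑ k, Real.log (hopEig σ k ^ 2) < 0 :=
        mul_neg_of_pos_of_neg (by positivity) (not_le.mp hneg)
      rw [h] at h3
      exact absurd h3 (not_lt.mpr (mul_nonneg (by positivity) h1))
    simp only [Real.log_pow, ← Finset.mul_sum] at h2
    simp only [Real.log_abs]
    push_cast at h2
    linarith
  have hlow : -(2 * (L : ℝ) ^ 2) ≤ ∑ k, (Real.log (β * t * |hopEig σ k|) -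
      Real.log (1 + β * t * |hopEig σ k|)) := by
    -- As βt ≥ 2 and |λ| ≤ 3, one has 1 + βt|λ| ≤ 4βt, and log 4 ≤ 2.
    have hterm : ∀ k ∈ Finset.univ, -2 + Real.log |hopEig σ k| ≤
        Real.log (β * t * |hopEig σ k|) - Real.log (1 + β * t * |hopEig σ k|) := by
      intro k _
      have hk := abs_pos.mpr (h0 k)
      have hk3 : |hopEig σ k| ≤ 3 := abs_le_of_sq_le_sq (by linarith [hsq8 k]) (by norm_num)
      have hb : 0 < β * t := by linarith
      have e1 : Real.log (1 + β * t * |hopEig σ k|) ≤ Real.log (β * t * 4) := by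
        refine Real.log_le_log (by positivity) ?_
        nlinarith
      rw [Real.log_mul hb.ne' (by norm_num)] at e1
      rw [Real.log_mul hb.ne' hk.ne']
      have e2 : Real.log 4 ≤ 2 := by
        rw [show (4 : ℝ) = 2 ^ 2 by norm_num, Real.log_pow]
        have := Real.log_two_lt_d9
        push_cast
        linarith
      linarith
    refine le_trans ?_ (Finset.sum_le_sum hterm)
    rw [Finset.sum_add_distrib, Finset.sum_const, Finset.card_univ, card_site, nsmul_eq_mul]
    push_cast
    linarith
  obtain ⟨hpos, hest⟩ := free_energy_estimate h4 s ht hβ0 σ h0 hlow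
  refine ⟨hpos, ?_⟩
  have havg : (∑ k, |hopEig σ k|) / (L : ℝ) ^ 2 =
      (∑ p ∈ Finset.range M, ∑ q ∈ Finset.range M,
          √(4 + 2 * Real.cos (twistAngle M (-1) p) +
            2 * Real.cos (twistAngle M (-1) q))) / (M : ℝ) ^ 2 := by
    rw [div_eq_div_iff (by positivity) (by positivity), sum_abs_hopEig, mul_comm,
      hden Real.sqrt, mul_comm]
  rwa [havg] at hest

/-- The free energy of the chessboard configuration in finite volume. -/
theorem chess_free_energy {ℓ : ℕ} (hℓ : 0 < ℓ) (hL : L = 4 * ℓ) (s : ℤˣ) {t β : ℝ} (ht : 0 < t)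
    (hβ : 2 / t ≤ β) {σ : GaugeField L} {a b : ℤˣ} (hσ : HasFluxes σ (chessFlux L) a b) :
    0 < partitionOf s t β σ ∧
      |Real.log (partitionOf s t β σ) / (β * (L : ℝ) ^ 2) -
        t / 4 * ((∑ p ∈ Finset.range ℓ, ∑ q ∈ Finset.range ℓ,
          (√(4 + √(8 + 2 * Real.cos (twistAngle ℓ a p) + 2 * Real.cos (twistAngle ℓ b q))) +
           √(4 - √(8 + 2 * Real.cos (twistAngle ℓ a p) + 2 * Real.cos (twistAngle ℓ b q))))) /
          (ℓ : ℝ) ^ 2)| ≤ 2 / β := by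
  have hβ0 : 0 < β := lt_of_lt_of_le (by positivity) hβ
  have hβt : 2 ≤ β * t := by rwa [div_le_iff₀ ht] at hβ
  have hℓ' : (0 : ℝ) < ℓ := by exact_mod_cast hℓ
  have hL0 : (0 : ℝ) < L := by exact_mod_cast Nat.pos_of_ne_zero (NeZero.ne L)
  obtain ⟨hσ1, hσ2, hσ3⟩ := hσ
  have hden := chess_density hℓ hL hσ1
  have hl0 : loopFlux σ 0 = a := hσ2
  have hl1 : loopFlux σ 1 = b := hσ3
  simp only [hl0, hl1] at hden
  -- The smallest possible λ² is 4 - √12, and √12 < 15/4.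
  have hsq : ∀ k, 1 / 4 ≤ hopEig σ k ^ 2 := by
    intro k
    have h := hden fun x => if x < 1 / 4 then 1 else 0
    rw [Finset.sum_eq_zero (s := Finset.range ℓ) fun p hp => Finset.sum_eq_zero fun q _ => by
      have h1 := Real.cos_le_one (twistAngle ℓ a p)
      have h2 := Real.cos_le_one (twistAngle ℓ b q)
      have h3 : √(8 + 2 * Real.cos (twistAngle ℓ a p) + 2 * Real.cos (twistAngle ℓ b q)) ≤
          15 / 4 := by
        rw [Real.sqrt_le_left (by norm_num)]
        linarith
      have h4 := Real.sqrt_nonneg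
        (8 + 2 * Real.cos (twistAngle ℓ a p) + 2 * Real.cos (twistAngle ℓ b q))
      rw [if_neg (by linarith), if_neg (by linarith), add_zero], mul_zero] at h
    exact not_lt.mp (sum_indicator_eq_zero (P := fun x => x < 1 / 4)
      ((mul_eq_zero.mp h).resolve_left (by positivity)) k)
  have habs : ∀ k, 1 / 2 ≤ |hopEig σ k| := fun k => by
    have := hsq k
    rw [← sq_abs] at this
    nlinarith [abs_nonneg (hopEig σ k)]
  have h0 : ∀ k, hopEig σ k ≠ 0 := fun k => abs_pos.mp (by linarith [habs k])
  have hlow : -(2 * (L : ℝ) ^ 2) ≤ ∑ k, (Real.log (β * t * |hopEig σ k|) -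
      Real.log (1 + β * t * |hopEig σ k|)) := by
    -- The gap |λ| ≥ 1/2 and βt ≥ 2 give y ≥ 1, so the difference is at least -log 2.
    have hterm : ∀ k ∈ Finset.univ, (-2 : ℝ) ≤
        Real.log (β * t * |hopEig σ k|) - Real.log (1 + β * t * |hopEig σ k|) := by
      intro k _
      have hy : 1 ≤ β * t * |hopEig σ k| := by nlinarith [habs k]
      set y := β * t * |hopEig σ k|
      have e1 : Real.log (1 + y) ≤ Real.log (y * 2) :=
        Real.log_le_log (by linarith) (by linarith)
      rw [Real.log_mul (by linarith) (by norm_num)] at e1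
      have := Real.log_two_lt_d9
      linarith
    refine le_trans ?_ (Finset.sum_le_sum hterm)
    rw [Finset.sum_const, Finset.card_univ, card_site, nsmul_eq_mul]
    push_cast
    linarith
  obtain ⟨hpos, hest⟩ := free_energy_estimate ⟨ℓ, hL⟩ s ht hβ0 σ h0 hlow
  refine ⟨hpos, ?_⟩
  have havg : t / 2 * ((∑ k, |hopEig σ k|) / (L : ℝ) ^ 2) = t / 4 *
      ((∑ p ∈ Finset.range ℓ, ∑ q ∈ Finset.range ℓ,
          (√(4 + √(8 + 2 * Real.cos (twistAngle ℓ a p) + 2 * Real.cos (twistAngle ℓ b q))) +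
           √(4 - √(8 + 2 * Real.cos (twistAngle ℓ a p) + 2 * Real.cos (twistAngle ℓ b q))))) /
          (ℓ : ℝ) ^ 2) := by
    have h := hden Real.sqrt
    rw [← sum_abs_hopEig] at h
    field_simp
    linear_combination 2 * h
  rwa [havg] at hest

/-! ### Gauge fields realizing the fluxes -/

section Existence

/-- Vertical spins alternating with x₁ give flux π everywhere. The factor η inserts one -1 along
each loop direction; it enters every plaquette in equal pairs, so it changes only the loop fluxes.
-/
theorem exists_pi_flux (h4 : 4 ∣ L) : ∃ σ : GaugeField L, HasFluxes σ (piFlux L) (-1) (-1) := by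
  set γ : ZMod 4 → ℤˣ := fun a => if a = 0 ∨ a = 2 then 1 else -1 with hγ
  have hγ1 : ∀ a, γ a * γ (a - 1) = -1 := by rw [hγ]; decide
  set η : ZMod L → ℤˣ := fun i => if i = 0 then -1 else 1 with hη
  have hηp : ∏ i, η i = -1 := by
    rw [hη, Finset.prod_ite_eq' Finset.univ (0 : ZMod L) fun _ => (-1 : ℤˣ)]
    simp
  refine ⟨fun e => if e.2 = 0 then η e.1.1 else γ (mod4 h4 e.1.1) * η e.1.2, ?_, ?_, ?_⟩
  · intro p
    have h1 := hγ1 (mod4 h4 p.1)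
    have h2 : ∀ u : ℤˣ, u * u = 1 := Int.units_mul_self
    simp only [plaquetteFlux, unitVec, piFlux]
    simp only [if_true, one_ne_zero, if_false, Prod.fst_sub, Prod.snd_sub, sub_zero, mod4_sub_one]
    calc _ = (η (p.1 - 1) * η (p.1 - 1)) * (η (p.2 - 1) * η (p.2 - 1)) *
        (γ (mod4 h4 p.1) * γ (mod4 h4 p.1 - 1)) := by
          ac_rfl
      _ = -1 := by rw [h2, h2, h1]; simp
  · simp only [loopFluxH, if_true]
    exact hηp
  · simp only [loopFluxV, one_ne_zero, if_false]
    rw [← hηp]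
    refine Finset.prod_congr rfl fun j _ => ?_
    simp [mod4, hγ]

/-- With trivial horizontal spins, the flux is the product of two neighbouring vertical spins. The
row pattern +, +, -, - makes it alternate between π and 0, and the pattern +, -, +, - makes it π
throughout. One pair of loop fluxes suffices to make the maximum positive. -/
theorem exists_chess_flux (h4 : 4 ∣ L) : ∃ σ : GaugeField L, HasFluxes σ (chessFlux L) 1 1 := by
  set γ : ZMod 4 → ZMod 4 → ℤˣ := fun a b =>
    if b = 0 ∨ b = 2 then (if a = 0 ∨ a = 1 then 1 else -1)
    else (if a = 0 ∨ a = 2 then 1 else -1) with hγ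
  have hγ1 : ∀ a b, γ a (b - 1) * γ (a - 1) (b - 1) =
      if (a = 1 ∨ a = 3) ∧ (b = 1 ∨ b = 3) then 1 else -1 := by rw [hγ]; decide
  have hγ0 : ∀ b, γ 0 b = 1 := by rw [hγ]; decide
  refine ⟨fun e => if e.2 = 0 then 1 else γ (mod4 h4 e.1.1) (mod4 h4 e.1.2), ?_, ?_, ?_⟩
  · intro p
    have h1 := hγ1 (mod4 h4 p.1) (mod4 h4 p.2)
    simp only [plaquetteFlux, unitVec, chessFlux, odd_val_iff h4]
    simp only [if_true, one_ne_zero, if_false, Prod.fst_sub, Prod.snd_sub, sub_zero,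
      mod4_sub_one, one_mul, mul_one]
    exact h1
  · simp [loopFluxH]
  · simp only [loopFluxV, one_ne_zero, if_false]
    refine Finset.prod_eq_one fun j _ => ?_
    have : mod4 h4 (0 : ZMod L) = 0 := by simp [mod4]
    rw [this, hγ0]

end Existence

/-- The estimates use a gauge field only through its fluxes, so an arbitrary choice will do and
gauge invariance is not needed. -/
theorem partitionStar_eq (h4 : 4 ∣ L) (s : ℤˣ) (t β : ℝ) :
    ∃ σ : GaugeField L, HasFluxes σ (piFlux L) (-1) (-1) ∧
      partitionStar L s t β = partitionOf s t β σ := by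
  have h := exists_pi_flux h4
  exact ⟨h.choose, h.choose_spec, by rw [partitionStar, partitionFn, dif_pos h]⟩

/-- The maximum over the loop fluxes is attained by some gauge field. -/
theorem partitionChessMax_eq {ℓ : ℕ} (hℓ : 0 < ℓ) (hL : L = 4 * ℓ) (s : ℤˣ) {t β : ℝ}
    (ht : 0 < t) (hβ : 2 / t ≤ β) :
    ∃ (a b : ℤˣ) (σ : GaugeField L), HasFluxes σ (chessFlux L) a b ∧
      partitionChessMax L s t β = partitionOf s t β σ := by
  have h11 := exists_chess_flux (L := L) ⟨ℓ, hL⟩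
  have hpos : 0 < partitionFn L s t β (chessFlux L) 1 1 := by
    rw [partitionFn, dif_pos h11]
    exact (chess_free_energy hℓ hL s ht hβ h11.choose_spec).1
  have hle : partitionFn L s t β (chessFlux L) 1 1 ≤ partitionChessMax L s t β :=
    Finset.le_sup' (fun ab : ℤˣ × ℤˣ => partitionFn L s t β (chessFlux L) ab.1 ab.2)
      (Finset.mem_univ ((1, 1) : ℤˣ × ℤˣ))
  obtain ⟨⟨a, b⟩, -, hab⟩ := Finset.exists_mem_eq_sup' (Finset.univ_nonempty (α := ℤˣ × ℤˣ))
    (fun ab : ℤˣ × ℤˣ => partitionFn L s t β (chessFlux L) ab.1 ab.2)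
  change partitionChessMax L s t β = partitionFn L s t β (chessFlux L) a b at hab
  -- The maximum is at least the positive value at (1, 1), so it is not the default value 0 of
  -- unattainable fluxes.
  have hex : ∃ σ : GaugeField L, HasFluxes σ (chessFlux L) a b := by
    by_contra hne
    have h0 : partitionFn L s t β (chessFlux L) a b = 0 := by rw [partitionFn, dif_neg hne]
    linarith
  exact ⟨a, b, hex.choose, hex.choose_spec, by rw [hab, partitionFn, dif_pos hex]⟩

/-! ### Infinite-volume limits -/

theorem sqrt_four_mul (x : ℝ) : √(4 * x) = 2 * √x := by
  rw [Real.sqrt_mul (by norm_num), show (4 : ℝ) = 2 ^ 2 by norm_num,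
    Real.sqrt_sq (by norm_num)]

/-- The infinite-volume limit of the ground state energy density of the `π`-flux phase. -/
theorem pi_energy_limit {ε : ℝ} (hε : 0 < ε) : ∃ M₀ : ℕ, ∀ M : ℕ, M₀ ≤ M →
    |(∑ p ∈ Finset.range M, ∑ q ∈ Finset.range M,
        √(4 + 2 * Real.cos (twistAngle M (-1) p) + 2 * Real.cos (twistAngle M (-1) q))) /
        (M : ℝ) ^ 2 -
      1 / (2 * Real.pi ^ 2) * ∫ k₁ in (0 : ℝ)..(2 * Real.pi), ∫ k₂ in (0 : ℝ)..(2 * Real.pi),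
        √(1 + 1 / 2 * Real.cos k₁ + 1 / 2 * Real.cos k₂)| ≤ ε := by
  have hf : Continuous (Function.uncurry fun x y : ℝ =>
      √(1 + 1 / 2 * Real.cos x + 1 / 2 * Real.cos y)) := by
    unfold Function.uncurry
    fun_prop
  obtain ⟨M₀, h⟩ := riemann_sum_two hf (half_pos hε)
  refine ⟨M₀, fun M hM => ?_⟩
  have h1 := h M hM (-1) (-1)
  have e : ∀ x y : ℝ, √(4 + 2 * Real.cos x + 2 * Real.cos y) =
      2 * √(1 + 1 / 2 * Real.cos x + 1 / 2 * Real.cos y) := fun x y => by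
    rw [← sqrt_four_mul]; congr 1; ring
  simp only [e, ← Finset.mul_sum]
  rw [abs_le] at h1 ⊢
  have h2 : 1 / (2 * Real.pi ^ 2) = 2 * (1 / (4 * Real.pi ^ 2)) := by
    have := Real.pi_ne_zero
    field_simp
    norm_num
  rw [h2, mul_div_assoc, mul_assoc 2]
  constructor <;> linarith [h1.1, h1.2]

/-- The infinite-volume limit of the ground state energy density of the chessboard
configuration. -/
theorem chess_energy_limit {ε : ℝ} (hε : 0 < ε) : ∃ M₀ : ℕ, ∀ M : ℕ, M₀ ≤ M → ∀ a b : ℤˣ,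
    |(∑ p ∈ Finset.range M, ∑ q ∈ Finset.range M,
        (√(4 + √(8 + 2 * Real.cos (twistAngle M a p) + 2 * Real.cos (twistAngle M b q))) +
         √(4 - √(8 + 2 * Real.cos (twistAngle M a p) + 2 * Real.cos (twistAngle M b q))))) /
        (M : ℝ) ^ 2 -
      1 / (2 * Real.pi ^ 2) *
        ((∫ k₁ in (0 : ℝ)..(2 * Real.pi), ∫ k₂ in (0 : ℝ)..(2 * Real.pi),
          √(1 + 1 / 2 * √(1 + Real.cos k₁ ^ 2 + Real.cos k₂ ^ 2))) +
        ∫ k₁ in (0 : ℝ)..(2 * Real.pi), ∫ k₂ in (0 : ℝ)..(2 * Real.pi),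
          √(1 - 1 / 2 * √(1 + Real.cos k₁ ^ 2 + Real.cos k₂ ^ 2)))| ≤ ε := by
  have hF₁ : Continuous (Function.uncurry fun u v : ℝ => √(1 + 1 / 2 * √(1 + u + v))) := by
    unfold Function.uncurry
    fun_prop
  have hF₂ : Continuous (Function.uncurry fun u v : ℝ => √(1 - 1 / 2 * √(1 + u + v))) := by
    unfold Function.uncurry
    fun_prop
  -- The spectrum gives cos θ linearly while the claim has cos² k; the two are related by θ = 2k.
  have i1 := integral_cos_sq hF₁
  have i2 := integral_cos_sq hF₂
  set f₁ : ℝ → ℝ → ℝ := fun x y =>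
    √(1 + 1 / 2 * √(1 + (1 + Real.cos x) / 2 + (1 + Real.cos y) / 2)) with hf₁
  set f₂ : ℝ → ℝ → ℝ := fun x y =>
    √(1 - 1 / 2 * √(1 + (1 + Real.cos x) / 2 + (1 + Real.cos y) / 2)) with hf₂
  have hc₁ : Continuous (Function.uncurry f₁) := by
    rw [hf₁]; unfold Function.uncurry; fun_prop
  have hc₂ : Continuous (Function.uncurry f₂) := by
    rw [hf₂]; unfold Function.uncurry; fun_prop
  -- Two branches, each with a factor 2 pulled out of its square root, turn ε / 4 into ε.
  obtain ⟨M₁, h₁⟩ := riemann_sum_two hc₁ (show 0 < ε / 4 by positivity)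
  obtain ⟨M₂, h₂⟩ := riemann_sum_two hc₂ (show 0 < ε / 4 by positivity)
  refine ⟨max M₁ M₂, fun M hM a b => ?_⟩
  have h1 := h₁ M ((le_max_left _ _).trans hM) a b
  have h2 := h₂ M ((le_max_right _ _).trans hM) a b
  have e0 : ∀ x y : ℝ, √(8 + 2 * Real.cos x + 2 * Real.cos y) =
      2 * √(1 + (1 + Real.cos x) / 2 + (1 + Real.cos y) / 2) := fun x y => by
    rw [← sqrt_four_mul]; congr 1; ring
  have hg₁ : ∀ z : ℝ, √(4 + 2 * z) = 2 * √(1 + 1 / 2 * z) := fun z => by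
    rw [← sqrt_four_mul]; congr 1; ring
  have hg₂ : ∀ z : ℝ, √(4 - 2 * z) = 2 * √(1 - 1 / 2 * z) := fun z => by
    rw [← sqrt_four_mul]; congr 1; ring
  have e1 : ∀ x y : ℝ, √(4 + √(8 + 2 * Real.cos x + 2 * Real.cos y)) = 2 * f₁ x y :=
    fun x y => by rw [e0, hg₁]
  have e2 : ∀ x y : ℝ, √(4 - √(8 + 2 * Real.cos x + 2 * Real.cos y)) = 2 * f₂ x y :=
    fun x y => by rw [e0, hg₂]
  simp only [e1, e2, Finset.sum_add_distrib, ← Finset.mul_sum]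
  rw [i1, i2]
  rw [abs_le] at h1 h2 ⊢
  have h3 : 1 / (2 * Real.pi ^ 2) = 2 * (1 / (4 * Real.pi ^ 2)) := by
    have := Real.pi_ne_zero
    field_simp
    norm_num
  rw [h3, add_div, mul_div_assoc, mul_div_assoc, mul_assoc 2, mul_add (1 / (4 * Real.pi ^ 2))]
  constructor <;> linarith [h1.1, h1.2, h2.1, h2.2]

end

end Z2Gauge

end

/-! ### Assembly of the error terms -/

theorem proposition3p3 (t : ℝ) (ht : 0 < t) (s : ℤˣ) :
    ∀ ε : ℝ, 0 < ε → ∃ β₀ : ℝ, 0 < β₀ ∧ ∃ ℓ₀ : ℕ, ∀ β : ℝ, β₀ ≤ β → ∀ ℓ : ℕ, ℓ₀ ≤ ℓ →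
      ∀ (L : ℕ) [NeZero L], L = 4 * ℓ →
        0 < Z2Gauge.partitionStar L s t β ∧
        0 < Z2Gauge.partitionChessMax L s t β ∧
        |Z2Gauge.monopoleMass L s t β -
          (t / (4 * Real.pi ^ 2) *
              (∫ k₁ in (0 : ℝ)..(2 * Real.pi), ∫ k₂ in (0 : ℝ)..(2 * Real.pi),
                Real.sqrt (1 + 1 / 2 * Real.cos k₁ + 1 / 2 * Real.cos k₂))
            - t / (8 * Real.pi ^ 2) *
              (∫ k₁ in (0 : ℝ)..(2 * Real.pi), ∫ k₂ in (0 : ℝ)..(2 * Real.pi),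
                Real.sqrt (1 + 1 / 2 * Real.sqrt (1 + Real.cos k₁ ^ 2 + Real.cos k₂ ^ 2)))
            - t / (8 * Real.pi ^ 2) *
              (∫ k₁ in (0 : ℝ)..(2 * Real.pi), ∫ k₂ in (0 : ℝ)..(2 * Real.pi),
                Real.sqrt (1 - 1 / 2 * Real.sqrt (1 + Real.cos k₁ ^ 2 + Real.cos k₂ ^ 2))))| < ε := by
  intro ε hε
  -- The error has four parts of at most ε / 8 each: the two thermal errors 2 / β, and the two
  -- Riemann errors ε / (4t) with prefactors at most t / 2.
  have hδ : 0 < ε / (4 * t) := by positivity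
  obtain ⟨M₁, h₁⟩ := Z2Gauge.pi_energy_limit hδ
  obtain ⟨M₂, h₂⟩ := Z2Gauge.chess_energy_limit hδ
  -- The bound 2 / t ensures βt ≥ 2 for the free energy estimates, and 16 / ε ensures 2 / β ≤ ε / 8.
  refine ⟨max (2 / t) (16 / ε), lt_of_lt_of_le (by positivity) (le_max_left _ _),
    max 1 (max M₁ M₂), ?_⟩
  intro β hβ ℓ hℓ L _ hL
  have hβ1 : 2 / t ≤ β := (le_max_left _ _).trans hβ
  have hβ2 : 16 / ε ≤ β := (le_max_right _ _).trans hβ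
  have hβ0 : 0 < β := lt_of_lt_of_le (by positivity) hβ1
  have hβε : 2 / β ≤ ε / 8 := by
    rw [div_le_iff₀ hε] at hβ2
    rw [div_le_div_iff₀ hβ0 (by norm_num)]
    linarith
  have hℓ0 : 0 < ℓ := lt_of_lt_of_le one_pos ((le_max_left _ _).trans hℓ)
  have hℓ1 : M₁ ≤ 2 * ℓ := by
    have : M₁ ≤ ℓ := (le_max_left _ _).trans ((le_max_right _ _).trans hℓ)
    omega
  have hℓ2 : M₂ ≤ ℓ := (le_max_right _ _).trans ((le_max_right _ _).trans hℓ)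
  obtain ⟨σ, hσ, hZ⟩ := Z2Gauge.partitionStar_eq (L := L) ⟨ℓ, hL⟩ s t β
  obtain ⟨a, b, τ, hτ, hZ'⟩ := Z2Gauge.partitionChessMax_eq hℓ0 hL s ht hβ1
  obtain ⟨p1, q1⟩ := Z2Gauge.pi_free_energy hℓ0 hL s ht hβ1 hσ
  obtain ⟨p2, q2⟩ := Z2Gauge.chess_free_energy hℓ0 hL s ht hβ1 hτ
  refine ⟨hZ ▸ p1, hZ' ▸ p2, ?_⟩
  have r1 := h₁ (2 * ℓ) hℓ1
  have r2 := h₂ ℓ hℓ2 a b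
  have hL0 : (0 : ℝ) < L := by exact_mod_cast Nat.pos_of_ne_zero (NeZero.ne L)
  rw [Z2Gauge.monopoleMass, hZ, hZ']
  have hmass : -(1 / (β * (L : ℝ) ^ 2)) * (Real.log (Z2Gauge.partitionOf s t β τ) -
      Real.log (Z2Gauge.partitionOf s t β σ)) =
      Real.log (Z2Gauge.partitionOf s t β σ) / (β * (L : ℝ) ^ 2) -
        Real.log (Z2Gauge.partitionOf s t β τ) / (β * (L : ℝ) ^ 2) := by
    field_simp
    ring
  rw [hmass]
  generalize Real.log (Z2Gauge.partitionOf s t β σ) / (β * (L : ℝ) ^ 2) = z₁ at q1 ⊢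
  generalize Real.log (Z2Gauge.partitionOf s t β τ) / (β * (L : ℝ) ^ 2) = z₂ at q2 ⊢
  generalize (∫ k₁ in (0 : ℝ)..(2 * Real.pi), ∫ k₂ in (0 : ℝ)..(2 * Real.pi),
    Real.sqrt (1 + 1 / 2 * Real.cos k₁ + 1 / 2 * Real.cos k₂)) = I₁ at r1 ⊢
  generalize (∫ k₁ in (0 : ℝ)..(2 * Real.pi), ∫ k₂ in (0 : ℝ)..(2 * Real.pi),
    Real.sqrt (1 + 1 / 2 * Real.sqrt (1 + Real.cos k₁ ^ 2 + Real.cos k₂ ^ 2))) = I₂ at r2 ⊢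
  generalize (∫ k₁ in (0 : ℝ)..(2 * Real.pi), ∫ k₂ in (0 : ℝ)..(2 * Real.pi),
    Real.sqrt (1 - 1 / 2 * Real.sqrt (1 + Real.cos k₁ ^ 2 + Real.cos k₂ ^ 2))) = I₃ at r2 ⊢
  have hscale : ∀ {c x : ℝ}, 0 ≤ c → c ≤ t / 2 → |x| ≤ ε / (4 * t) → |c * x| ≤ ε / 8 := by
    intro c x hc hct hx
    rw [abs_mul, abs_of_nonneg hc]
    refine (mul_le_mul hct hx (abs_nonneg _) (by positivity)).trans (le_of_eq ?_)
    field_simp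
    norm_num
  have r1' := hscale (c := t / 2) (by positivity) le_rfl r1
  have r2' := hscale (c := t / 4) (by positivity) (by linarith) r2
  rw [mul_sub] at r1' r2'
  have e1 : t / 2 * (1 / (2 * Real.pi ^ 2) * I₁) = t / (4 * Real.pi ^ 2) * I₁ := by
    have := Real.pi_ne_zero
    field_simp
    ring
  have e2 : t / 4 * (1 / (2 * Real.pi ^ 2) * (I₂ + I₃)) =
      t / (8 * Real.pi ^ 2) * I₂ + t / (8 * Real.pi ^ 2) * I₃ := by
    have := Real.pi_ne_zero
    field_simp
    ring
  rw [e1] at r1'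
  rw [e2] at r2'
  rw [abs_le] at q1 q2 r1' r2'
  rw [abs_lt]
  constructor <;> linarith [q1.1, q1.2, q2.1, q2.2, r1'.1, r1'.2, r2'.1, r2'.2]
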